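/- **Setting.** Let $(X,d)$ be a complete separable metric space and let $\varphi:[0,\infty)\to[0,\infty]$ be continuous, decreasing, and finite on $(0,\infty)$. For a Borel measure $\nu$ on $X$ put $I_\varphi(\nu)=\iint\varphi(d(x,y))\,d\nu(x)\,d\nu(y)$. Every locally finite Borel measure $\nu$ on $X$ decomposes uniquely as $\nu=\nu_R+\nu_\perp$ with locally finite $\nu_R\perp\nu_\perp$ such that $\nu_\perp$ is singular to every locally finite Borel measure of finite $\varphi$-energy and $\nu_R=\nu|_{\bigcup_n A_n}=\sum_n\nu|_{A_n}$ for some disjoint Borel sets $A_n$ with $I_\varphi(\nu|_{A_n})<\infty$. Let $\mathcal Q_k$ ($k\ge1$) be countable families of pairwise disjoint Borel subsets of $X$ with $\lim_k\sup\{\operatorname{diam}Q:Q\in\mathcal Q_k\}=0$ such that for $k>1$ each $Q\in\mathcal Q_k$ is contained in exactly one $D\in\mathcal Q_{k-1}$. Let $X_0=\bigcap_k\bigcup_{Q\in\mathcal Q_k}Q$. Let $B$ be a random closed subset of $X$ on a probability space $(\Omega,\mathcal A,P)$ such that $\{B\cap K\ne\emptyset\}\in\mathcal A$ for every compact $K$,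 and $\{B\cap Q\ne\emptyset\}\in\mathcal A$ and $P(B\cap Q\neq\emptyset)>0$ for every $Q\in\mathcal Q_k$, $k\ge1$. Put $$\mathcal C_k(\nu)=\sum_{Q\in\mathcal Q_k}P(Q\cap B\ne\emptyset)^{-1}\,I_{\{Q\cap B\ne\emptyset\}}\,\nu|_Q .$$ **Conditional measure.** Random measures $\mu_k$ converge to $\mu$ *weakly, subsequentially in probability*, if every subsequence has a further subsequence along which $\mu_k\to\mu$ weakly almost surely; they converge *vaguely in probability* if $\int f\,d\mu_k\to\int f\,d\mu$ in probability for every continuous compactly supported $f$. For finite $\tau$ we write $\mathcal C(\tau)=\sigma$ if $\sigma$ is a random finite Borel measure and $\mathcal C_k(\tau)\to\sigma$ weakly, subsequentially in probability. In the locally finite setting (with $X$ locally compact and $\tau$ locally finite) we write $\mathcal C(\tau)=\sigma$ if $\sigma$ is a random locally finite Borel measure and $\mathcal C_k(\tau)\to\sigma$ vaguely in probability. Such limits are almost surely unique. *The conditional measure of $\nu$ on $B$ exists (with respect to $(\mathcal Q_k)$, with regularity kernel $\varphi$)* if there is a random measure $\mathcal C(\nu)$ (finite, respectively locally finite) such that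 1. $\mathcal C_k(\nu)\to\mathcal C(\nu)$ in the above sense; 2. for every Borel $f:X\to\mathbb R$ with $\int|f|\,d\nu<\infty$, $\int f\,d\mathcal C_k(\nu)$ converges in probability to a random variable $S(f)$, and $E\big(\int f\,d\mathcal C(\nu)\big)=E(S(f))=\int f\,d\nu_R$; 3. for all countable collections of such $f_n$, almost surely $\int f_n\,d\mathcal C(\nu)=S(f_n)$ for every $n$; 4. for all countable collections of Borel sets $A_n$ with $\nu(A_n)<\infty$, almost surely $S(\chi_{A_n})=\mathcal C(\nu)(A_n)$ for every $n$; 5. $E(\mathcal C(\nu)(A))=E(S(\chi_A))=\nu_R(A)\le\nu(A)$ for every Borel $A$ with $\nu(A)<\infty$; 6. $\mathcal C_k(\nu_R)(A)\to\mathcal C(\nu)(A)$ in $\mathcal L^1$ for every Borel $A$ with $\nu(A)<\infty$; 7. $\mathcal C(\nu_\perp)=0$ almost surely; 8. $\mathcal C(\nu)=\mathcal C(\nu_R)$ almost surely; 9. if $\nu=\sum_{i=1}^\infty\nu^i$ with locally finite Borel measures $\nu^i$, then $\mathcal C(\nu)=\sum_i\mathcal C(\nu^i)$ almost surely; 10.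 for every Borel $f\ge0$ with $\int f\,d\nu<\infty$ (in the locally finite setting: such that every point of $X$ has a neighbourhood $U$ with $\int_U f\,d\nu<\infty$), $\mathcal C(f\,d\nu)=f\,d\mathcal C(\nu)$ almost surely; in particular $\mathcal C(\gamma\nu)=\gamma\,\mathcal C(\nu)$ for $\gamma\in[0,\infty)$; 11. $\operatorname{supp}\mathcal C(\nu)\subseteq\operatorname{supp}\nu\cap B$ almost surely. Here statements 7–10 include that the limits $\mathcal C(\cdot)$ occurring in them exist. **Theorem.** Let $\nu$ be a finite Borel measure on $X$, or let $X$ be locally compact and $\nu$ a locally finite Borel measure on $X$; assume $\nu(X\setminus X_0)=0$. Then the conditional measure $\mathcal C(\nu)$ of $\nu$ on $B$ exists with respect to $(\mathcal Q_k)$ with regularity kernel $\varphi$ (in the sense of the finite setting, respectively of the locally finite setting) if and only if * $\mathcal C_k(\nu|_D)(X)=\mathcal C_k(\nu)(D)$ converges in $\mathcal L^1$ as $k\to\infty$ for every compact $D\subseteq X$ with $I_\varphi(\nu|_D)<\infty$, and * $\mathcal C_k(\nu_\perp)(D)\to0$ in probability as $k\to\infty$ for every compact $D\subseteq X$. -/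

import Mathlib

open MeasureTheory Filter Topology Set
open scoped ENNReal NNReal

namespace RandomRestriction

noncomputable section

/-! ### Energy and the decomposition into regular and singular parts -/

/-- The `φ`-energy `∬ φ(d(x,y)) dν(x) dν(y)`. -/
def energy {X : Type*} [MetricSpace X] [MeasurableSpace X] (φ : ℝ≥0 → ℝ≥0∞)
    (ν : Measure X) : ℝ≥0∞ :=
  ∫⁻ x, ∫⁻ y, φ (nndist x y) ∂ν ∂ν

theorem energy_lt_top_of_le_smul {X : Type*} [MetricSpace X] [MeasurableSpace X]
    {φ : ℝ≥0 → ℝ≥0∞} {μ τ : Measure X} {c : ℝ≥0∞} (hc : c ≠ ∞) (h : μ ≤ c • τ)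
    (hτ : energy φ τ < ∞) : energy φ μ < ∞ := by
  have h1 : energy φ μ ≤ ∫⁻ x, ∫⁻ y, φ (nndist x y) ∂(c • τ) ∂(c • τ) :=
    lintegral_mono' h (fun x => lintegral_mono' h le_rfl)
  refine h1.trans_lt ?_
  simp only [lintegral_smul_measure, smul_eq_mul]
  rw [lintegral_const_mul' _ _ hc]
  exact ENNReal.mul_lt_top hc.lt_top (ENNReal.mul_lt_top hc.lt_top hτ)

/-- `ν = νR + νS` is the decomposition of `ν` into its `φ`-regular part `νR` and its
`φ`-singular part `νS`. -/
structure IsDecomposition {X : Type*} [MetricSpace X] [MeasurableSpace X]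
    (φ : ℝ≥0 → ℝ≥0∞) (ν νR νS : Measure X) : Prop where
  locallyFinite_regular : IsLocallyFiniteMeasure νR
  locallyFinite_singular : IsLocallyFiniteMeasure νS
  eq_add : ν = νR + νS
  mutuallySingular : νR ⟂ₘ νS
  singular : ∀ τ : Measure X, IsLocallyFiniteMeasure τ → energy φ τ < ∞ → νS ⟂ₘ τ
  exists_sets : ∃ A : ℕ → Set X, (∀ n, MeasurableSet (A n)) ∧
    Pairwise (fun m n => Disjoint (A m) (A n)) ∧
    νR = ν.restrict (⋃ n, A n) ∧
    νR = Measure.sum (fun n => ν.restrict (A n)) ∧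
    ∀ n, energy φ (ν.restrict (A n)) < ∞

theorem exists_isDecomposition {X : Type*} [MetricSpace X] [SecondCountableTopology X]
    [MeasurableSpace X] [BorelSpace X] (φ : ℝ≥0 → ℝ≥0∞) (ν : Measure X)
    [IsLocallyFiniteMeasure ν] :
    ∃ p : Measure X × Measure X, IsDecomposition φ ν p.1 p.2 := by
  obtain ⟨m, hm, hνm, hmν⟩ := exists_isFiniteMeasure_absolutelyContinuous ν
  let good : Set (ℕ → Set X) :=
    {A | ∀ n, MeasurableSet (A n) ∧ energy φ (ν.restrict (A n)) < ∞}
  have hgood0 : (fun _ => ∅ : ℕ → Set X) ∈ good := by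
    intro n
    simp [energy]
  let v : Set ℝ≥0∞ := (fun A : ℕ → Set X => m (⋃ n, A n)) '' good
  obtain ⟨u, -, hu, huv⟩ := exists_seq_tendsto_sSup (S := v) ⟨_, _, hgood0, rfl⟩
    (OrderTop.bddAbove _)
  choose F hF hFu using huv
  -- merge the countably many families into one
  let G : ℕ → Set X := fun n => F n.unpair.1 n.unpair.2
  have hG : G ∈ good := fun n => hF _ _
  have hGU : ∀ n, (⋃ k, F n k) ⊆ ⋃ k, G k := by
    intro n
    refine iUnion_subset fun k => ?_
    refine subset_iUnion_of_subset (Nat.pair n k) ?_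
    simp [G]
  have hGsup : sSup v ≤ m (⋃ k, G k) := by
    refine le_of_tendsto' hu fun n => ?_
    rw [← hFu n]
    exact measure_mono (hGU n)
  let A : ℕ → Set X := disjointed G
  have hAm : ∀ n, MeasurableSet (A n) := fun n =>
    MeasurableSet.disjointed (fun k => (hG k).1) n
  have hAU : (⋃ n, A n) = ⋃ n, G n := iUnion_disjointed
  have hAd : Pairwise (fun i j => Disjoint (A i) (A j)) := disjoint_disjointed G
  have hUm : MeasurableSet (⋃ n, A n) := MeasurableSet.iUnion hAm
  have hAe : ∀ n, energy φ (ν.restrict (A n)) < ∞ := by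
    intro n
    refine energy_lt_top_of_le_smul (c := 1) ENNReal.one_ne_top ?_ (hG n).2
    rw [one_smul]
    exact Measure.restrict_mono (disjointed_subset G n) le_rfl
  -- maximality
  have hmax : ∀ C, MeasurableSet C → C ⊆ (⋃ n, A n)ᶜ → energy φ (ν.restrict C) < ∞ →
      ν C = 0 := by
    intro C hC hCA hCe
    refine hνm ?_
    let H : ℕ → Set X := fun n => Nat.casesOn n C G
    have hH : H ∈ good := by
      intro n
      cases n with
      | zero => exact ⟨hC, hCe⟩
      | succ k => exact hG k
    have hHU : (⋃ n, H n) = C ∪ ⋃ n, G n := by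
      ext x
      simp only [mem_iUnion, mem_union]
      constructor
      · rintro ⟨n, hn⟩
        cases n with
        | zero => exact Or.inl hn
        | succ k => exact Or.inr ⟨k, hn⟩
      · rintro (h | ⟨k, hk⟩)
        · exact ⟨0, h⟩
        · exact ⟨k + 1, hk⟩
    have h1 : m (C ∪ ⋃ n, G n) ≤ m (⋃ n, G n) := by
      rw [← hHU]
      have hv : m (⋃ n, H n) ∈ v := ⟨H, hH, rfl⟩
      exact (le_sSup hv).trans hGsup
    have hdisj : Disjoint C (⋃ n, G n) := by
      rw [← hAU]
      exact disjoint_left.2 fun x hx => hCA hx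
    rw [measure_union hdisj (hAU ▸ hUm)] at h1
    by_contra hne
    have := ENNReal.lt_add_right (measure_ne_top m (⋃ n, G n)) hne
    rw [add_comm] at this
    exact absurd h1 (not_le.2 this)
  refine ⟨(ν.restrict (⋃ n, A n), ν.restrict (⋃ n, A n)ᶜ), ?_, ?_, ?_, ?_, ?_, ?_⟩
  · dsimp only
    infer_instance
  · dsimp only
    infer_instance
  · exact (Measure.restrict_add_restrict_compl hUm).symm
  · refine ⟨(⋃ n, A n)ᶜ, hUm.compl, ?_, ?_⟩
    · rw [Measure.restrict_apply hUm.compl, compl_inter_self, measure_empty]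
    · rw [compl_compl, Measure.restrict_apply hUm, inter_compl_self, measure_empty]
  · intro τ hτ hτe
    dsimp only
    set νS := ν.restrict (⋃ n, A n)ᶜ with hνS
    obtain ⟨s, hs, hs1, hs2⟩ := Measure.mutuallySingular_singularPart νS τ
    have hgm : Measurable (νS.rnDeriv τ) := Measure.measurable_rnDeriv νS τ
    have hg : ∀ᵐ x ∂τ, νS.rnDeriv τ x < ∞ := Measure.rnDeriv_lt_top νS τ
    let T : ℕ → Set X := fun N => s ∩ (⋃ n, A n)ᶜ ∩ {x | νS.rnDeriv τ x ≤ N}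
    have hTm : ∀ N, MeasurableSet (T N) := fun N =>
      (hs.inter hUm.compl).inter (measurableSet_le hgm measurable_const)
    have hT : ∀ N, ν (T N) = 0 := by
      intro N
      refine hmax _ (hTm N) (fun x hx => hx.1.2) ?_
      refine energy_lt_top_of_le_smul (c := N) (ENNReal.natCast_ne_top N) ?_ hτe
      refine Measure.le_iff.2 fun E hE => ?_
      rw [Measure.restrict_apply hE]
      have e1 : ν (E ∩ T N) = νS (E ∩ T N) := by
        rw [hνS, Measure.restrict_apply (hE.inter (hTm N))]
        congr 1
        ext x
        constructor
        · exact fun hx => ⟨hx, hx.2.1.2⟩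
        · exact fun hx => hx.1
      rw [e1]
      conv_lhs => rw [Measure.haveLebesgueDecomposition_add νS τ]
      rw [Measure.add_apply]
      have e2 : νS.singularPart τ (E ∩ T N) = 0 :=
        measure_mono_null (fun x hx => hx.2.1.1) hs1
      rw [e2, zero_add, withDensity_apply _ (hE.inter (hTm N))]
      calc ∫⁻ x in E ∩ T N, νS.rnDeriv τ x ∂τ
          ≤ ∫⁻ _ in E ∩ T N, (N : ℝ≥0∞) ∂τ :=
            setLIntegral_mono measurable_const (fun x hx => hx.2.2)
        _ = N * τ (E ∩ T N) := by rw [setLIntegral_const]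
        _ ≤ N * τ E := by gcongr; exact inter_subset_left
        _ = ((N : ℝ≥0∞) • τ) E := by simp
    refine ⟨s ∩ {x | νS.rnDeriv τ x < ∞}, hs.inter (measurableSet_lt hgm measurable_const),
      ?_, ?_⟩
    · rw [hνS, Measure.restrict_apply (hs.inter (measurableSet_lt hgm measurable_const))]
      refine measure_mono_null ?_ (measure_iUnion_null hT)
      rintro x ⟨⟨hxs, hxg⟩, hxA⟩
      obtain ⟨N, hN⟩ := ENNReal.exists_nat_gt (ne_of_lt hxg)
      exact mem_iUnion.2 ⟨N, ⟨hxs, hxA⟩, hN.le⟩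
    · rw [compl_inter]
      exact measure_union_null hs2 hg
  · exact ⟨A, hAm, hAd, rfl, Measure.restrict_iUnion hAd hAm, hAe⟩

section Parts

variable {X : Type*} [MetricSpace X] [SecondCountableTopology X] [MeasurableSpace X]
  [BorelSpace X]

/-- The `φ`-regular part of `ν` (the decomposition is unique). -/
def regularPart (φ : ℝ≥0 → ℝ≥0∞) (ν : Measure X) [IsLocallyFiniteMeasure ν] : Measure X :=
  (exists_isDecomposition φ ν).choose.1

/-- The `φ`-singular part of `ν` (the decomposition is unique). -/
def singularPart (φ : ℝ≥0 → ℝ≥0∞) (ν : Measure X) [IsLocallyFiniteMeasure ν] : Measure X :=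
  (exists_isDecomposition φ ν).choose.2

theorem isDecomposition_parts (φ : ℝ≥0 → ℝ≥0∞) (ν : Measure X) [IsLocallyFiniteMeasure ν] :
    IsDecomposition φ ν (regularPart φ ν) (singularPart φ ν) :=
  (exists_isDecomposition φ ν).choose_spec

end Parts

/-! ### Kernels, partitions, random closed sets -/

/-- `φ : [0,∞) → [0,∞]` is continuous, decreasing, and finite on `(0,∞)`. -/
structure IsKernel (φ : ℝ≥0 → ℝ≥0∞) : Prop where
  continuous : Continuous φ
  antitone : Antitone φ
  ne_top : ∀ r, 0 < r → φ r ≠ ∞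

/-- A sequence of countable families of pairwise disjoint Borel sets, with diameters tending
to zero uniformly, each member of a family lying in exactly one member of the previous family. -/
structure IsNestedSequence {X : Type*} [MetricSpace X] [MeasurableSpace X]
    (𝒬 : ℕ → Set (Set X)) : Prop where
  countable : ∀ k, (𝒬 k).Countable
  measurableSet : ∀ k, ∀ Q ∈ 𝒬 k, MeasurableSet Q
  disjoint : ∀ k, ∀ Q ∈ 𝒬 k, ∀ S ∈ 𝒬 k, Q ≠ S → Q ∩ S = ∅
  tendsto_diam : Tendsto (fun k => ⨆ Q ∈ 𝒬 k, Metric.ediam Q) atTop (𝓝 0)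
  existsUnique_parent : ∀ k, ∀ Q ∈ 𝒬 (k + 1), ∃! D, D ∈ 𝒬 k ∧ Q ⊆ D

/-- The set `X₀ = ⋂ₖ ⋃_{Q ∈ 𝒬ₖ} Q`. -/
def coveredSet {X : Type*} (𝒬 : ℕ → Set (Set X)) : Set X := ⋂ k, ⋃ Q ∈ 𝒬 k, Q

section Random

variable {X Ω : Type*} [MetricSpace X] [MeasurableSpace X] [MeasurableSpace Ω]

/-- The event `B ∩ Q ≠ ∅`. -/
def hitEvent (B : Ω → Set X) (Q : Set X) : Set Ω := {ω | (B ω ∩ Q).Nonempty}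

/-- `B` is a random closed set whose hitting events of compact sets and of members of the
families are events, the latter with positive probability. -/
structure IsRandomClosedSet (P : Measure Ω) (𝒬 : ℕ → Set (Set X)) (B : Ω → Set X) : Prop where
  isClosed : ∀ ω, IsClosed (B ω)
  measurableSet_hit_compact : ∀ K, IsCompact K → MeasurableSet (hitEvent B K)
  measurableSet_hit : ∀ k, ∀ Q ∈ 𝒬 k, MeasurableSet (hitEvent B Q)
  hit_pos : ∀ k, ∀ Q ∈ 𝒬 k, 0 < P (hitEvent B Q)

open Classical in
/-- The random measure `𝒞ₖ(ν) = ∑_{Q ∈ 𝒬ₖ} P(Q ∩ B ≠ ∅)⁻¹ I_{Q ∩ B ≠ ∅} ν|_Q`. -/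
def condApprox (P : Measure Ω) (𝒬 : ℕ → Set (Set X)) (B : Ω → Set X) (ν : Measure X)
    (k : ℕ) (ω : Ω) : Measure X :=
  Measure.sum fun Q : 𝒬 k =>
    (if ω ∈ hitEvent B (Q : Set X) then (P (hitEvent B (Q : Set X)))⁻¹ else 0) •
      ν.restrict (Q : Set X)

/-! ### Random measures and their convergence -/

/-- A random finite Borel measure, as an almost everywhere defined random element. -/
structure IsRandomFiniteMeasure (P : Measure Ω) (μ : Ω → Measure X) : Prop where
  aemeasurable : AEMeasurable μ P
  finite : ∀ᵐ ω ∂P, IsFiniteMeasure (μ ω)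

/-- A random locally finite Borel measure, as an almost everywhere defined random element. -/
structure IsRandomLocallyFiniteMeasure (P : Measure Ω) (μ : Ω → Measure X) : Prop where
  aemeasurable : AEMeasurable μ P
  locallyFinite : ∀ᵐ ω ∂P, IsLocallyFiniteMeasure (μ ω)

/-- Weak convergence of a sequence of (finite) measures. -/
def WeaklyConverges (m : ℕ → Measure X) (μ : Measure X) : Prop :=
  ∀ f : BoundedContinuousFunction X ℝ,
    Tendsto (fun k => ∫ x, f x ∂(m k)) atTop (𝓝 (∫ x, f x ∂μ))

/-- Weak convergence subsequentially in probability: every subsequence has a further subsequence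
that converges weakly almost surely. -/
def WeaklyConvergesSubseq (P : Measure Ω) (m : ℕ → Ω → Measure X) (μ : Ω → Measure X) : Prop :=
  ∀ α : ℕ → ℕ, StrictMono α → ∃ β : ℕ → ℕ, StrictMono β ∧
    ∀ᵐ ω ∂P, WeaklyConverges (fun k => m (α (β k)) ω) (μ ω)

/-- Vague convergence in probability. -/
def VaguelyConvergesInProbability (P : Measure Ω) (m : ℕ → Ω → Measure X)
    (μ : Ω → Measure X) : Prop :=
  ∀ f : X → ℝ, Continuous f → HasCompactSupport f →
    TendstoInMeasure P (fun k ω => ∫ x, f x ∂(m k ω)) atTop (fun ω => ∫ x, f x ∂(μ ω))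

/-- `Y k → Z` in `ℒ¹`. -/
def ConvergesInL1To (P : Measure Ω) (Y : ℕ → Ω → ℝ) (Z : Ω → ℝ) : Prop :=
  (∀ k, Integrable (Y k) P) ∧ Integrable Z P ∧
    Tendsto (fun k => ∫⁻ ω, ‖Y k ω - Z ω‖ₑ ∂P) atTop (𝓝 0)

/-! ### The conditional measure -/

/-- `μ` is the (almost surely unique) random finite measure that `𝒞ₖ(ν)` converges to weakly,
subsequentially in probability. This is the meaning of `𝒞(ν) = μ` almost surely, for finite
measures. -/
def IsWeakLimit (P : Measure Ω) (𝒬 : ℕ → Set (Set X)) (B : Ω → Set X) (ν : Measure X)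
    (μ : Ω → Measure X) : Prop :=
  IsRandomFiniteMeasure P μ ∧ WeaklyConvergesSubseq P (condApprox P 𝒬 B ν) μ

/-- `μ` is the (almost surely unique) random locally finite measure that `𝒞ₖ(ν)` converges to
vaguely in probability. This is the meaning of `𝒞(ν) = μ` almost surely, for locally finite
measures on a locally compact space. -/
def IsVagueLimit (P : Measure Ω) (𝒬 : ℕ → Set (Set X)) (B : Ω → Set X) (ν : Measure X)
    (μ : Ω → Measure X) : Prop :=
  IsRandomLocallyFiniteMeasure P μ ∧ VaguelyConvergesInProbability P (condApprox P 𝒬 B ν) μ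

variable [SecondCountableTopology X] [BorelSpace X]

/-- The properties of the conditional measure `μ = 𝒞(ν)`, with `S f` the limit in probability of
`∫ f d𝒞ₖ(ν)`. The predicate `IsLim τ σ` stands for `𝒞(τ) = σ` almost surely (it is `IsWeakLimit`
or `IsVagueLimit` below), and `Adm f` for the class of nonnegative densities `f` such that
`𝒞(f dν) = f d𝒞(ν)` is required. -/
structure CondMeasureProps (P : Measure Ω) (𝒬 : ℕ → Set (Set X)) (B : Ω → Set X)
    (φ : ℝ≥0 → ℝ≥0∞) (ν : Measure X) [IsLocallyFiniteMeasure ν]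
    (IsLim : Measure X → (Ω → Measure X) → Prop) (Adm : (X → ℝ≥0) → Prop)
    (μ : Ω → Measure X) (S : (X → ℝ) → Ω → ℝ) : Prop where
  /-- `𝒞ₖ(ν)` converges to `𝒞(ν)`. -/
  isLim : IsLim ν μ
  /-- `∫ f d𝒞ₖ(ν) → S(f)` in probability, `E(∫ f d𝒞(ν)) = E(S(f)) = ∫ f dν_R`. -/
  integral_tendsto : ∀ f : X → ℝ, Measurable f → Integrable f ν →
    TendstoInMeasure P (fun k ω => ∫ x, f x ∂(condApprox P 𝒬 B ν k ω)) atTop (S f) ∧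
    Integrable (S f) P ∧ Integrable (fun ω => ∫ x, f x ∂(μ ω)) P ∧
    ∫ ω, ∫ x, f x ∂(μ ω) ∂P = ∫ ω, S f ω ∂P ∧
    ∫ ω, S f ω ∂P = ∫ x, f x ∂(regularPart φ ν)
  /-- Almost surely `∫ fₙ d𝒞(ν) = S(fₙ)` for all `n`. -/
  integral_eq : ∀ f : ℕ → X → ℝ, (∀ n, Measurable (f n)) → (∀ n, Integrable (f n) ν) →
    ∀ᵐ ω ∂P, ∀ n, Integrable (f n) (μ ω) ∧ ∫ x, f n x ∂(μ ω) = S (f n) ω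
  /-- Almost surely `S(χ_{Aₙ}) = 𝒞(ν)(Aₙ)` for all `n`. -/
  measure_eq : ∀ A : ℕ → Set X, (∀ n, MeasurableSet (A n)) → (∀ n, ν (A n) < ∞) →
    ∀ᵐ ω ∂P, ∀ n, μ ω (A n) < ∞ ∧ S ((A n).indicator 1) ω = (μ ω).real (A n)
  /-- `E(𝒞(ν)(A)) = E(S(χ_A)) = ν_R(A) ≤ ν(A)`. -/
  expectation_eq : ∀ A : Set X, MeasurableSet A → ν A < ∞ →
    ∫⁻ ω, μ ω A ∂P = regularPart φ ν A ∧
    ∫ ω, S (A.indicator 1) ω ∂P = (regularPart φ ν).real A ∧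
    regularPart φ ν A ≤ ν A
  /-- `𝒞ₖ(ν_R)(A) → 𝒞(ν)(A)` in `ℒ¹`. -/
  tendsto_L1 : ∀ A : Set X, MeasurableSet A → ν A < ∞ →
    ConvergesInL1To P (fun k ω => (condApprox P 𝒬 B (regularPart φ ν) k ω).real A)
      (fun ω => (μ ω).real A)
  /-- `𝒞(ν_⊥) = 0`. -/
  singular_zero : IsLim (singularPart φ ν) (fun _ => 0)
  /-- `𝒞(ν) = 𝒞(ν_R)`. -/
  regular_eq : IsLim (regularPart φ ν) μ
  /-- If `ν = ∑ νⁱ` then `𝒞(ν) = ∑ 𝒞(νⁱ)`. -/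
  sum_eq : ∀ νs : ℕ → Measure X, (∀ i, IsLocallyFiniteMeasure (νs i)) → ν = Measure.sum νs →
    ∃ σ : ℕ → Ω → Measure X, (∀ i, IsLim (νs i) (σ i)) ∧
      ∀ᵐ ω ∂P, μ ω = Measure.sum (fun i => σ i ω)
  /-- `𝒞(f dν) = f d𝒞(ν)`. -/
  density_eq : ∀ f : X → ℝ≥0, Measurable f → Adm f →
    IsLim (ν.withDensity fun x => f x) (fun ω => (μ ω).withDensity fun x => f x)
  /-- In particular `𝒞(γ ν) = γ 𝒞(ν)`. -/
  smul_eq : ∀ γ : ℝ≥0, IsLim (γ • ν) (fun ω => γ • μ ω)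
  /-- `supp 𝒞(ν) ⊆ supp ν ∩ B` almost surely. -/
  support_subset : ∀ᵐ ω ∂P, (μ ω).support ⊆ ν.support ∩ B ω

/-- The conditional measure of the finite measure `ν` on `B` exists and it is `μ`. -/
def IsCondMeasureFinite (P : Measure Ω) (𝒬 : ℕ → Set (Set X)) (B : Ω → Set X)
    (φ : ℝ≥0 → ℝ≥0∞) (ν : Measure X) [IsLocallyFiniteMeasure ν] (μ : Ω → Measure X) : Prop :=
  ∃ S : (X → ℝ) → Ω → ℝ,
    CondMeasureProps P 𝒬 B φ ν (IsWeakLimit P 𝒬 B) (fun f => ∫⁻ x, f x ∂ν < ∞) μ S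

/-- The conditional measure of the locally finite measure `ν` on `B` exists and it is `μ`
(for locally compact `X`). -/
def IsCondMeasureLocallyFinite (P : Measure Ω) (𝒬 : ℕ → Set (Set X)) (B : Ω → Set X)
    (φ : ℝ≥0 → ℝ≥0∞) (ν : Measure X) [IsLocallyFiniteMeasure ν] (μ : Ω → Measure X) : Prop :=
  ∃ S : (X → ℝ) → Ω → ℝ,
    CondMeasureProps P 𝒬 B φ ν (IsVagueLimit P 𝒬 B)
      (fun f => ∀ y, ∃ U ∈ 𝓝 y, ∫⁻ x in U, f x ∂ν < ∞) μ S

/-- `𝒞ₖ(ν)(D)` converges in `ℒ¹` for every compact `D` such that `ν|_D` has finite energy, and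
`𝒞ₖ(ν_⊥)(D)` converges to `0` in probability for every compact `D`. -/
def ExistenceCriterion (P : Measure Ω) (𝒬 : ℕ → Set (Set X)) (B : Ω → Set X)
    (φ : ℝ≥0 → ℝ≥0∞) (ν : Measure X) [IsLocallyFiniteMeasure ν] : Prop :=
  (∀ D : Set X, IsCompact D → energy φ (ν.restrict D) < ∞ →
    ∃ Z : Ω → ℝ, ConvergesInL1To P (fun k ω => (condApprox P 𝒬 B ν k ω).real D) Z) ∧
  (∀ D : Set X, IsCompact D →
    TendstoInMeasure P (fun k ω => (condApprox P 𝒬 B (singularPart φ ν) k ω).real D) atTop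
      (fun _ => 0))

end Random

end

end RandomRestriction

open RandomRestriction

/-! Every approximation 𝒞ₖ(ν) has intensity exactly ν: each weight has expectation 1, and the cells
of each generation cover ν-almost all of X (`bind_condApprox`). Hence for A' ⊆ A the ℒ¹-distance of
𝒞ₖ(ν)(A) and 𝒞ₖ(ν)(A') is ν(A \ A'), uniformly in k, so convergence passes from compact sets to all
Borel sets of finite measure by inner regularity.

Sufficiency. A set of finite energy is ν_⊥-null, so on it the criterion speaks about 𝒞ₖ(ν_R).
Exhausting ν_R by the sets Aₙ of its decomposition gives ℒ¹-limits Z(A) of 𝒞ₖ(ν_R)(A) whenever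
ν_R(A) < ∞. These limits have expectation ν_R(A) and are almost surely additive for each pair of
disjoint sets; `exists_randomMeasure` realises them by one random measure μ, by means of
distribution functions after embedding X into ℝ. Likewise 𝒞ₖ(ν_⊥)(A) → 0 in probability. Together, μ
is the limit of 𝒞ₖ(ν)(A) in probability for each A of finite measure (`IsSetwiseLimit`), with
intensity ν_R. The required properties follow: integrals by approximation in L¹(ν), weak convergence
by testing countably many open sets, densities because 𝒞ₖ commutes with them, sums by Radon–Nikodym
derivatives, the support because small cells away from B carry no mass.

Necessity. On D of finite energy the approximations of ν and of ν_R agree, so property 6 is the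
first condition. For compact D, 𝒞ₖ(ν_⊥)(D) is the difference of 𝒞ₖ(ν)(D) and 𝒞ₖ(ν_R)(D), which share
the limit 𝒞(ν)(D). -/

namespace RandomRestriction

/-! ### Random measures from additive families of random variables -/

section Construction

variable {X Ω : Type*} [MeasurableSpace X] [MeasurableSpace Ω]

/-- A family of nonnegative random variables indexed by measurable sets which is almost surely
finitely additive, with intensity measure `m`. -/
structure IsAdditiveFamily (P : Measure Ω) (m : Measure X) (M : Set X → Ω → ℝ≥0∞) : Prop where
  aemeasurable : ∀ A, MeasurableSet A → AEMeasurable (M A) P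
  lintegral_eq : ∀ A, MeasurableSet A → ∫⁻ ω, M A ω ∂P = m A
  union : ∀ A A', MeasurableSet A → MeasurableSet A' → Disjoint A A' →
    ∀ᵐ ω ∂P, M (A ∪ A') ω = M A ω + M A' ω

namespace IsAdditiveFamily

variable {P : Measure Ω} {m : Measure X} {M : Set X → Ω → ℝ≥0∞}

theorem mono (h : IsAdditiveFamily P m M) {A A' : Set X} (hA : MeasurableSet A)
    (hA' : MeasurableSet A') (hAA' : A ⊆ A') : ∀ᵐ ω ∂P, M A ω ≤ M A' ω := by
  filter_upwards [h.union A (A' \ A) hA (hA'.diff hA) disjoint_sdiff_self_right] with ω hω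
  rw [union_sdiff_cancel hAA'] at hω
  exact hω ▸ le_self_add

theorem lt_top (h : IsAdditiveFamily P m M) {A : Set X} (hA : MeasurableSet A)
    (hmA : m A ≠ ∞) : ∀ᵐ ω ∂P, M A ω < ∞ :=
  ae_lt_top' (h.aemeasurable A hA) (by rwa [h.lintegral_eq A hA])

/-- Almost sure continuity at the empty set: the infimum of the variables has expectation at most
every m(Aₙ), hence zero, and the sequence is almost surely decreasing. It replaces countable
additivity, which is not assumed. -/
theorem tendsto_zero (h : IsAdditiveFamily P m M) {A : ℕ → Set X}
    (hA : ∀ n, MeasurableSet (A n)) (hanti : Antitone A) (hfin : m (A 0) ≠ ∞)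
    (hnull : m (⋂ n, A n) = 0) : ∀ᵐ ω ∂P, Tendsto (fun n => M (A n) ω) atTop (𝓝 0) := by
  have h0 : ∀ᵐ ω ∂P, ⨅ n, M (A n) ω = 0 := by
    have hm : AEMeasurable (fun ω => ⨅ n, M (A n) ω) P :=
      AEMeasurable.iInf fun n => h.aemeasurable _ (hA n)
    refine (lintegral_eq_zero_iff' hm).1 ?_
    have hlim := tendsto_measure_iInter_atTop (μ := m) (fun n => (hA n).nullMeasurableSet) hanti
      ⟨0, hfin⟩
    rw [hnull] at hlim
    refine le_antisymm (ge_of_tendsto' hlim fun n => ?_) zero_le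
    exact (lintegral_mono fun ω => iInf_le _ n).trans_eq (h.lintegral_eq _ (hA n))
  have hmono : ∀ᵐ ω ∂P, ∀ n, M (A (n + 1)) ω ≤ M (A n) ω :=
    ae_all_iff.2 fun n => h.mono (hA _) (hA _) (hanti n.le_succ)
  filter_upwards [h0, hmono] with ω hω hω'
  rw [← hω]
  exact tendsto_atTop_iInf (antitone_nat_of_succ_le hω')

end IsAdditiveFamily

/-- Normalised by the total mass, q ↦ M(Iic q) on the rationals is almost surely a distribution
function, since this amounts to countably many almost sure conditions. It defines a measurable
family of probability measures, which is rescaled; agreement with M then spreads from half-lines to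
Borel sets by π-λ induction, with a null set depending on the set. -/
theorem exists_randomMeasure_real {P : Measure Ω} {m : Measure ℝ} [IsFiniteMeasure m]
    {M : Set ℝ → Ω → ℝ≥0∞} (h : IsAdditiveFamily P m M)
    (hM : ∀ A, MeasurableSet A → Measurable (M A)) :
    ∃ κ : Ω → Measure ℝ, Measurable κ ∧ ∀ A, MeasurableSet A → ∀ᵐ ω ∂P, κ ω A = M A ω := by
  set f : Ω → ℚ → ℝ := fun ω q => (M (Iic (q : ℝ)) ω).toReal / (M univ ω).toReal with hf
  have hfm : Measurable f := measurable_pi_iff.2 fun q =>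
    ((hM _ measurableSet_Iic).ennreal_toReal).div ((hM _ MeasurableSet.univ).ennreal_toReal)
  have htop : ∀ᵐ ω ∂P, M univ ω < ∞ := h.lt_top MeasurableSet.univ (measure_ne_top _ _)
  have hle : ∀ᵐ ω ∂P, ∀ q : ℚ, M (Iic (q : ℝ)) ω ≤ M univ ω :=
    ae_all_iff.2 fun q => h.mono measurableSet_Iic MeasurableSet.univ (subset_univ _)
  have hmono : ∀ᵐ ω ∂P, ∀ p q : ℚ, p ≤ q → M (Iic (p : ℝ)) ω ≤ M (Iic (q : ℝ)) ω := by
    refine ae_all_iff.2 fun p => ae_all_iff.2 fun q => ?_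
    by_cases hpq : p ≤ q
    · filter_upwards [h.mono (measurableSet_Iic (a := (p : ℝ))) measurableSet_Iic
        (Iic_subset_Iic.2 (Rat.cast_le.2 hpq))] with ω hω _ using hω
    · exact Eventually.of_forall fun ω hpq' => absurd hpq' hpq
  have hbot : ∀ᵐ ω ∂P, Tendsto (fun n : ℕ => M (Iic (-(n : ℝ))) ω) atTop (𝓝 0) := by
    refine h.tendsto_zero (fun n => measurableSet_Iic) (fun i j hij => ?_) (measure_ne_top _ _) ?_
    · exact Iic_subset_Iic.2 (neg_le_neg (Nat.cast_le.2 hij))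
    · convert! measure_empty (μ := m)
      refine eq_empty_of_forall_notMem fun x hx => ?_
      obtain ⟨n, hn⟩ := exists_nat_gt (-x)
      have := mem_iInter.1 hx n
      simp only [mem_Iic] at this
      linarith
  have htopl : ∀ᵐ ω ∂P, Tendsto (fun n : ℕ => M (Ioi (n : ℝ)) ω) atTop (𝓝 0) := by
    refine h.tendsto_zero (fun n => measurableSet_Ioi) (fun i j hij => ?_) (measure_ne_top _ _) ?_
    · exact Ioi_subset_Ioi (Nat.cast_le.2 hij)
    · convert! measure_empty (μ := m)
      refine eq_empty_of_forall_notMem fun x hx => ?_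
      obtain ⟨n, hn⟩ := exists_nat_gt x
      have := mem_iInter.1 hx n
      simp only [mem_Ioi] at this
      linarith
  have htopa : ∀ᵐ ω ∂P, ∀ n : ℕ, M univ ω = M (Iic (n : ℝ)) ω + M (Ioi (n : ℝ)) ω := by
    refine ae_all_iff.2 fun n => ?_
    have := h.union (Iic (n : ℝ)) (Ioi (n : ℝ)) measurableSet_Iic measurableSet_Ioi
      (Iic_disjoint_Ioi le_rfl)
    rwa [Iic_union_Ioi] at this
  have hright : ∀ᵐ ω ∂P, ∀ t : ℚ,
      Tendsto (fun n : ℕ => M (Ioc (t : ℝ) (t + 1 / ((n : ℝ) + 1))) ω) atTop (𝓝 0) := by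
    refine ae_all_iff.2 fun t => h.tendsto_zero (fun n => measurableSet_Ioc) (fun i j hij => ?_)
      (measure_ne_top _ _) ?_
    · exact Ioc_subset_Ioc_right (by gcongr)
    · convert! measure_empty (μ := m)
      refine eq_empty_of_forall_notMem fun x hx => ?_
      have hx0 : (t : ℝ) < x := (mem_iInter.1 hx 0).1
      obtain ⟨n, hn⟩ := exists_nat_one_div_lt (sub_pos.2 hx0)
      have := (mem_iInter.1 hx n).2
      linarith
  have hrighta : ∀ᵐ ω ∂P, ∀ t : ℚ, ∀ n : ℕ, M (Iic ((t + 1 / ((n : ℚ) + 1) : ℚ) : ℝ)) ω =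
      M (Iic (t : ℝ)) ω + M (Ioc (t : ℝ) (t + 1 / ((n : ℝ) + 1))) ω := by
    refine ae_all_iff.2 fun t => ae_all_iff.2 fun n => ?_
    have := h.union (Iic (t : ℝ)) (Ioc (t : ℝ) (t + 1 / ((n : ℝ) + 1))) measurableSet_Iic
      measurableSet_Ioc ((Iic_disjoint_Ioi le_rfl).mono_right Ioc_subset_Ioi_self)
    rw [Iic_union_Ioc_eq_Iic (by simp only [le_add_iff_nonneg_right]; positivity)] at this
    push_cast
    exact this
  -- Where the total mass vanishes, every quotient is 0/0 = 0 and the limit at infinity would fail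
  -- to be 1.
  have hpoint : ∀ᵐ ω ∂P, M univ ω ≠ 0 → ProbabilityTheory.IsRatStieltjesPoint f ω := by
    filter_upwards [htop, hle, hmono, hbot, htopl, htopa, hright, hrighta] with
      ω htop hle hmono hbot htopl htopa hright hrighta h0
    have hT : 0 < (M univ ω).toReal := ENNReal.toReal_pos h0 htop.ne
    have hfin : ∀ q : ℚ, M (Iic (q : ℝ)) ω ≠ ∞ := fun q => ((hle q).trans_lt htop).ne
    have hmon : Monotone (f ω) := fun p q hpq =>
      div_le_div_of_nonneg_right (ENNReal.toReal_mono (hfin q) (hmono p q hpq)) hT.le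
    refine ⟨hmon, ?_, ?_, fun t => ?_⟩
    · refine (tendsto_iff_tendsto_subseq_of_monotone hmon
        (tendsto_natCast_atTop_atTop (R := ℚ))).2 ?_
      have h1 : Tendsto (fun n : ℕ => 1 - (M (Ioi (n : ℝ)) ω).toReal / (M univ ω).toReal) atTop
          (𝓝 (1 - (0 : ℝ≥0∞).toReal / (M univ ω).toReal)) :=
        (((ENNReal.tendsto_toReal ENNReal.zero_ne_top).comp htopl).div_const _).const_sub 1
      simp only [ENNReal.toReal_zero, zero_div, sub_zero] at h1
      refine h1.congr fun n => ?_
      have h2 := htopa n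
      have h3 : M (Ioi (n : ℝ)) ω ≠ ∞ := ne_top_of_le_ne_top htop.ne (h2 ▸ le_add_self)
      have h4 := congrArg ENNReal.toReal h2
      rw [ENNReal.toReal_add (by simpa using hfin n) h3] at h4
      simp only [Function.comp_apply, hf, Rat.cast_natCast]
      rw [eq_div_iff hT.ne', sub_mul, div_mul_cancel₀ _ hT.ne']
      linarith
    · have h1 : Tendsto (fun q : ℚ => f ω (-q)) atTop (𝓝 0) := by
        refine (tendsto_iff_tendsto_subseq_of_antitone (fun p q hpq => hmon (neg_le_neg hpq))
          (tendsto_natCast_atTop_atTop (R := ℚ))).2 ?_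
        have h1 := ((ENNReal.tendsto_toReal ENNReal.zero_ne_top).comp hbot).div_const
          (M univ ω).toReal
        simpa [Function.comp_def, hf] using h1
      simpa [Function.comp_def] using h1.comp tendsto_neg_atBot_atTop
    · have h1 : Tendsto (fun n : ℕ => f ω (t + 1 / ((n : ℚ) + 1))) atTop (𝓝 (f ω t)) := by
        have h1 : Tendsto (fun n : ℕ => M (Iic (t : ℝ)) ω +
            M (Ioc (t : ℝ) (t + 1 / ((n : ℝ) + 1))) ω) atTop (𝓝 (M (Iic (t : ℝ)) ω)) := by
          simpa using (hright t).const_add (M (Iic (t : ℝ)) ω)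
        have h2 := ((ENNReal.tendsto_toReal (hfin t)).comp h1).div_const (M univ ω).toReal
        refine h2.congr fun n => ?_
        simp only [Function.comp_apply, hf, hrighta]
      refine le_antisymm (ge_of_tendsto' h1 fun n => ?_) (le_ciInf fun r => hmon (le_of_lt r.2))
      refine ciInf_le (f := fun r : Ioi t => f ω r) ?_
        ⟨t + 1 / ((n : ℚ) + 1), by simp only [mem_Ioi, lt_add_iff_pos_right]; positivity⟩
      exact ⟨0, by rintro _ ⟨r, rfl⟩; positivity⟩
  -- Off the good points this takes a default distribution function, so it is always a probability
  -- measure; the factor in `κ` makes the choice harmless when the total mass is zero.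
  let μ : Ω → Measure ℝ := fun ω => (ProbabilityTheory.stieltjesOfMeasurableRat f hfm ω).measure
  have hμ : ∀ ω, IsProbabilityMeasure (μ ω) := fun ω => by
    dsimp only [μ]; infer_instance
  have hμm : Measurable μ := ProbabilityTheory.measurable_measure_stieltjesOfMeasurableRat hfm
  let κ : Ω → Measure ℝ := fun ω => M univ ω • μ ω
  have hκ : ∀ ω A, κ ω A = M univ ω * μ ω A := fun ω A => by simp [κ]
  have hκuniv : ∀ ω, κ ω univ = M univ ω := fun ω => by simp [hκ]
  refine ⟨κ, Measure.measurable_of_measurable_coe _ fun A hA => ?_, fun A hA => ?_⟩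
  · simp only [hκ]
    exact (hM _ MeasurableSet.univ).mul ((Measure.measurable_coe hA).comp hμm)
  have hgen : Real.measurableSpace = MeasurableSpace.generateFrom (⋃ a : ℚ, {Iic (a : ℝ)}) := by
    rw [← Real.borel_eq_generateFrom_Iic_rat]
    exact BorelSpace.measurable_eq
  induction A, hA using MeasurableSpace.induction_on_inter hgen Real.isPiSystem_Iic_rat with
  | empty =>
    filter_upwards [h.union ∅ ∅ MeasurableSet.empty MeasurableSet.empty (disjoint_empty _),
      h.lt_top MeasurableSet.empty (measure_ne_top _ _)] with ω hω hω'
    rw [union_empty] at hω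
    rw [measure_empty]
    by_contra hne
    exact absurd hω (ENNReal.lt_add_right hω'.ne (Ne.symm hne)).ne
  | basic A hA =>
    obtain ⟨q, hq⟩ := mem_iUnion.1 hA
    rw [mem_singleton_iff.1 hq]
    filter_upwards [hpoint, htop, hle] with ω hpoint htop hle
    rw [hκ]
    by_cases h0 : M univ ω = 0
    · have := hle q
      rw [h0] at this ⊢
      rw [zero_mul, nonpos_iff_eq_zero.1 this]
    · rw [ProbabilityTheory.measure_stieltjesOfMeasurableRat_Iic,
        ProbabilityTheory.stieltjesOfMeasurableRat_eq,
        ProbabilityTheory.toRatCDF_of_isRatStieltjesPoint (hpoint h0)]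
      rw [hf]
      dsimp only
      rw [← ENNReal.toReal_div, ENNReal.ofReal_toReal
        (ENNReal.div_ne_top ((hle q).trans_lt htop).ne h0), ENNReal.mul_div_cancel h0 htop.ne]
  | compl A hA ih =>
    filter_upwards [ih, h.union A Aᶜ hA hA.compl disjoint_compl_right, htop] with ω ih hω htop
    rw [union_compl_self] at hω
    have h1 := measure_add_measure_compl (μ := κ ω) hA
    rw [hκuniv, ih, hω] at h1
    exact (ENNReal.add_right_inj (ne_top_of_le_ne_top htop.ne (hω ▸ le_self_add))).1 h1
  | iUnion A hd hA ih =>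
    have hacc : ∀ n, MeasurableSet (accumulate A n) := fun n =>
      MeasurableSet.biUnion (to_countable _) fun i _ => hA i
    -- Finite additivity splits off the tail of the union, and the tail vanishes in the limit by
    -- `tendsto_zero`.
    have hpart : ∀ᵐ ω ∂P, ∀ n : ℕ, M (⋃ i, A i) ω =
        M (accumulate A n) ω + M ((⋃ i, A i) \ accumulate A n) ω := by
      refine ae_all_iff.2 fun n => ?_
      have := h.union (accumulate A n) ((⋃ i, A i) \ accumulate A n) (hacc n)
        ((MeasurableSet.iUnion hA).diff (hacc n)) disjoint_sdiff_self_right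
      rwa [union_sdiff_cancel (accumulate_subset_iUnion n)] at this
    have hsum : ∀ᵐ ω ∂P, ∀ n : ℕ, M (accumulate A n) ω = κ ω (accumulate A n) := by
      refine ae_all_iff.2 fun n => ?_
      induction n with
      | zero =>
        filter_upwards [ih 0] with ω hω
        rw [accumulate_zero_nat, hω]
      | succ n ihn =>
        have hdis : Disjoint (accumulate A n) (A (n + 1)) :=
          disjoint_accumulate hd n.lt_succ_self
        filter_upwards [ihn, ih (n + 1), h.union _ _ (hacc n) (hA (n + 1))
          hdis] with ω h1 h2 h3
        rw [accumulate_succ, h3, measure_union hdis (hA _), h1, h2]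
    have hlim : ∀ᵐ ω ∂P, Tendsto (fun n => M ((⋃ i, A i) \ accumulate A n) ω) atTop (𝓝 0) := by
      refine h.tendsto_zero (fun n => (MeasurableSet.iUnion hA).diff
        (hacc n)) (fun i j hij => ?_) (measure_ne_top _ _) ?_
      · exact sdiff_subset_sdiff_right (monotone_accumulate hij)
      · rw [← sdiff_iUnion, iUnion_accumulate, sdiff_self, measure_empty]
    filter_upwards [hpart, hsum, hlim] with ω hpart hsum hlim
    have h1 : Tendsto (fun n => κ ω (accumulate A n)) atTop (𝓝 (κ ω (⋃ i, A i))) := by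
      have := tendsto_measure_iUnion_atTop (μ := κ ω) (monotone_accumulate (s := A))
      rwa [iUnion_accumulate] at this
    have h2 := h1.add hlim
    rw [add_zero] at h2
    refine tendsto_nhds_unique h2 ?_
    refine tendsto_const_nhds.congr fun n => ?_
    rw [hpart n, hsum n]

/-- The family is pushed to ℝ along a measurable embedding and the random measure is pulled back by
`comap`. `M'` picks measurable versions of the variables, as the construction on ℝ demands. -/
theorem exists_randomMeasure_of_isFiniteMeasure [StandardBorelSpace X] {P : Measure Ω}
    {m : Measure X} [IsFiniteMeasure m] {M : Set X → Ω → ℝ≥0∞} (h : IsAdditiveFamily P m M) :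
    ∃ κ : Ω → Measure X, Measurable κ ∧ ∀ A, MeasurableSet A → ∀ᵐ ω ∂P, κ ω A = M A ω := by
  obtain ⟨e, he⟩ := exists_measurableEmbedding_real X
  classical
  let M' : Set ℝ → Ω → ℝ≥0∞ := fun E =>
    if hE : MeasurableSet E then (h.aemeasurable (e ⁻¹' E) (he.measurable hE)).mk else 0
  have hM' : ∀ E, MeasurableSet E → M (e ⁻¹' E) =ᵐ[P] M' E := fun E hE => by
    simp only [M', hE, dif_pos]
    exact AEMeasurable.ae_eq_mk _
  have hm' : ∀ E, MeasurableSet E → Measurable (M' E) := fun E hE => by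
    simp only [M', hE, dif_pos]
    exact AEMeasurable.measurable_mk _
  have h' : IsAdditiveFamily P (m.map e) M' := by
    refine ⟨fun E hE => (hm' E hE).aemeasurable, fun E hE => ?_, fun E E' hE hE' hd => ?_⟩
    · rw [← lintegral_congr_ae (hM' E hE), h.lintegral_eq _ (he.measurable hE),
        Measure.map_apply he.measurable hE]
    · filter_upwards [hM' E hE, hM' E' hE', hM' _ (hE.union hE'), h.union _ _ (he.measurable hE)
        (he.measurable hE') (hd.preimage e)] with ω h1 h2 h3 h4
      rw [← h1, ← h2, ← h3, preimage_union, h4]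
  obtain ⟨κ, hκ, hκM⟩ := exists_randomMeasure_real h' hm'
  have hc : ∀ ω A, (κ ω).comap e A = κ ω (e '' A) := fun ω A => he.comap_apply _ _
  refine ⟨fun ω => (κ ω).comap e, Measure.measurable_of_measurable_coe _ fun A hA => ?_,
    fun A hA => ?_⟩
  · simp only [hc]
    exact (Measure.measurable_coe (he.measurableSet_image.2 hA)).comp hκ
  · have hA' := he.measurableSet_image.2 hA
    filter_upwards [hκM _ hA', hM' _ hA'] with ω h1 h2
    rw [hc, h1, ← h2, preimage_image_eq _ he.injective]

/-- An almost surely additive family of random variables, defined on the sets of finite measure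
for the `σ`-finite intensity `m`, is induced by a random measure. -/
theorem exists_randomMeasure [StandardBorelSpace X] {P : Measure Ω} {m : Measure X} [SigmaFinite m]
    {M : Set X → Ω → ℝ≥0∞}
    (hM : ∀ A, MeasurableSet A → m A < ∞ → AEMeasurable (M A) P)
    (hint : ∀ A, MeasurableSet A → m A < ∞ → ∫⁻ ω, M A ω ∂P = m A)
    (hadd : ∀ A A', MeasurableSet A → MeasurableSet A' → m A < ∞ → m A' < ∞ → Disjoint A A' →
      ∀ᵐ ω ∂P, M (A ∪ A') ω = M A ω + M A' ω) :
    ∃ κ : Ω → Measure X, Measurable κ ∧ P.bind κ = m ∧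
      ∀ A, MeasurableSet A → m A < ∞ → ∀ᵐ ω ∂P, κ ω A = M A ω := by
  -- The finite case is applied on disjoint pieces of finite intensity, and the resulting random
  -- measures are summed.
  let E : ℕ → Set X := disjointed (spanningSets m)
  have hE : ∀ n, MeasurableSet (E n) := fun n =>
    MeasurableSet.disjointed (measurableSet_spanningSets m) n
  have hEfin : ∀ n, m (E n) < ∞ := fun n =>
    (measure_mono (disjointed_subset _ n)).trans_lt (measure_spanningSets_lt_top m n)
  have hEU : ⋃ n, E n = univ := by
    rw [iUnion_disjointed, iUnion_spanningSets]
  have hEd : Pairwise (fun i j => Disjoint (E i) (E j)) := disjoint_disjointed _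
  have hfam : ∀ n, IsAdditiveFamily P (m.restrict (E n)) (fun A => M (A ∩ E n)) := by
    intro n
    have hlt : ∀ A, m (A ∩ E n) < ∞ := fun A => (measure_mono inter_subset_right).trans_lt (hEfin n)
    refine ⟨fun A hA => hM _ (hA.inter (hE n)) (hlt A), fun A hA => ?_, fun A A' hA hA' hd => ?_⟩
    · rw [hint _ (hA.inter (hE n)) (hlt A), Measure.restrict_apply hA]
    · rw [union_inter_distrib_right]
      exact hadd _ _ (hA.inter (hE n)) (hA'.inter (hE n)) (hlt A) (hlt A')
        (hd.mono inter_subset_left inter_subset_left)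
  have hfinE : ∀ n, IsFiniteMeasure (m.restrict (E n)) := fun n =>
    ⟨by rw [Measure.restrict_apply_univ]; exact hEfin n⟩
  choose κ hκ hκM using fun n => exists_randomMeasure_of_isFiniteMeasure (hfam n)
  have hs : ∀ ω A, MeasurableSet A → Measure.sum (fun n => κ n ω) A = ∑' n, κ n ω A :=
    fun ω A hA => Measure.sum_apply _ hA
  have hmeas : Measurable fun ω => Measure.sum (fun n => κ n ω) := by
    refine Measure.measurable_of_measurable_coe _ fun A hA => ?_
    simp only [hs _ A hA]
    exact Measurable.tsum fun n => (Measure.measurable_coe hA).comp (hκ n)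
  have hbind : ∀ A, MeasurableSet A → ∫⁻ ω, Measure.sum (fun n => κ n ω) A ∂P = m A := by
    intro A hA
    simp only [hs _ A hA]
    rw [lintegral_tsum (f := fun n ω => κ n ω A)
      fun n => ((Measure.measurable_coe hA).comp (hκ n)).aemeasurable]
    have : m A = ∑' n, m.restrict (E n) A := by
      rw [← Measure.sum_apply _ hA, ← Measure.restrict_iUnion hEd hE, hEU, Measure.restrict_univ]
    rw [this]
    exact tsum_congr fun n => (lintegral_congr_ae (hκM n A hA)).trans ((hfam n).lintegral_eq A hA)
  refine ⟨fun ω => Measure.sum fun n => κ n ω, hmeas, ?_, fun A hA hAfin => ?_⟩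
  · ext A hA
    rw [Measure.bind_apply hA hmeas.aemeasurable, hbind A hA]
  -- Finite additivity yields only this inequality; equality is then forced because both sides have
  -- the same finite expectation.
  have hle : ∀ᵐ ω ∂P, ∀ n : ℕ, ∑ i ∈ Finset.range n, κ i ω A ≤ M A ω := by
    have hlt : ∀ B, m (A ∩ B) < ∞ := fun B => (measure_mono inter_subset_left).trans_lt hAfin
    have hmU : ∀ n, MeasurableSet (⋃ i ∈ Finset.range n, E i) := fun n =>
      Finset.measurableSet_biUnion _ fun i _ => hE i
    refine ae_all_iff.2 fun n => ?_
    have hEq : ∀ᵐ ω ∂P, ∑ i ∈ Finset.range n, κ i ω A +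
        M (A \ ⋃ i ∈ Finset.range n, E i) ω = M A ω := by
      induction n with
      | zero => simp
      | succ n ih =>
        have hsplit : A \ ⋃ i ∈ Finset.range n, E i =
            (A ∩ E n) ∪ (A \ ⋃ i ∈ Finset.range (n + 1), E i) := by
          have hdn : ∀ x ∈ E n, ∀ i < n, x ∉ E i := fun x hx i hi hxi =>
            disjoint_left.1 (hEd hi.ne) hxi hx
          ext x
          simp only [Set.mem_sdiff, mem_iUnion, Finset.mem_range, mem_union, mem_inter_iff,
            exists_prop, not_exists, not_and]
          constructor
          · rintro ⟨hx, hx'⟩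
            by_cases hxn : x ∈ E n
            · exact Or.inl ⟨hx, hxn⟩
            · refine Or.inr ⟨hx, fun i hi => ?_⟩
              rcases Nat.lt_succ_iff_lt_or_eq.1 hi with h | rfl
              · exact hx' i h
              · exact hxn
          · rintro (⟨hx, hxn⟩ | ⟨hx, hx'⟩)
            · exact ⟨hx, hdn x hxn⟩
            · exact ⟨hx, fun i hi => hx' i (hi.trans n.lt_succ_self)⟩
        have hdis : Disjoint (A ∩ E n) (A \ ⋃ i ∈ Finset.range (n + 1), E i) := by
          refine disjoint_left.2 fun x hx hx' => hx'.2 ?_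
          exact mem_biUnion (Finset.mem_coe.2 (Finset.self_mem_range_succ n)) hx.2
        filter_upwards [ih, hκM n A hA, hadd _ _ (hA.inter (hE n)) (hA.diff (hmU (n + 1)))
          (hlt _) ((measure_mono sdiff_subset).trans_lt hAfin) hdis] with ω h1 h2 h3
        rw [← h1, hsplit, h3, Finset.sum_range_succ, h2, add_assoc]
    filter_upwards [hEq] with ω hω
    rw [← hω]
    exact le_self_add
  refine ae_eq_of_ae_le_of_lintegral_le ?_ ?_ (hM A hA hAfin) ?_
  · filter_upwards [hle] with ω hω
    rw [hs ω A hA]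
    exact ENNReal.tsum_le_of_sum_range_le hω
  · rw [hbind A hA]; exact hAfin.ne
  · rw [hbind A hA, hint A hA hAfin]

end Construction

/-! ### Integration against random measures -/

section RandomMeasure

variable {X Ω : Type*} [MeasurableSpace X] [MeasurableSpace Ω] {P : Measure Ω}
  {κ : Ω → Measure X} {f : X → ℝ}

theorem aemeasurable_apply (hκ : AEMeasurable κ P) {A : Set X} (hA : MeasurableSet A) :
    AEMeasurable (fun ω => κ ω A) P :=
  (Measure.measurable_coe hA).comp_aemeasurable hκ

theorem aemeasurable_real (hκ : AEMeasurable κ P) {A : Set X} (hA : MeasurableSet A) :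
    AEMeasurable (fun ω => (κ ω).real A) P :=
  (aemeasurable_apply hκ hA).ennreal_toReal

theorem ae_apply_lt_top (hκ : AEMeasurable κ P) {A : Set X} (hA : MeasurableSet A)
    (hfin : P.bind κ A ≠ ∞) : ∀ᵐ ω ∂P, κ ω A < ∞ :=
  ae_lt_top' (aemeasurable_apply hκ hA) (by rwa [← Measure.bind_apply hA hκ])

theorem aemeasurable_lintegral (hκ : AEMeasurable κ P) {g : X → ℝ≥0∞}
    (hg : AEMeasurable g (P.bind κ)) : AEMeasurable (fun ω => ∫⁻ x, g x ∂κ ω) P := by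
  have h1 : AEMeasurable (fun ω => ∫⁻ x, hg.mk g x ∂κ ω) P :=
    (Measure.measurable_lintegral hg.measurable_mk).comp_aemeasurable hκ
  refine h1.congr ?_
  filter_upwards [Measure.ae_ae_of_ae_bind hκ hg.ae_eq_mk] with ω hω
  exact (lintegral_congr_ae hω).symm

/-- `P.bind κ` is the intensity A ↦ E κ(A), and expectations of integrals against `κ` are integrals
against it (Campbell's formula). This and the following lemmas are consequences. -/
theorem ae_integrable (hκ : AEMeasurable κ P) (hf : Integrable f (P.bind κ)) :
    ∀ᵐ ω ∂P, Integrable f (κ ω) := by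
  have h1 : ∫⁻ ω, ∫⁻ x, ‖f x‖ₑ ∂κ ω ∂P < ∞ := by
    rw [← Measure.lintegral_bind hκ hf.aestronglyMeasurable.enorm]
    exact hf.2
  filter_upwards [ae_lt_top' (aemeasurable_lintegral hκ hf.aestronglyMeasurable.enorm) h1.ne,
    Measure.ae_ae_of_ae_bind hκ hf.aestronglyMeasurable.ae_eq_mk] with ω h2 h3
  exact ⟨⟨_, hf.aestronglyMeasurable.stronglyMeasurable_mk, h3⟩, h2⟩

theorem integral_ae_eq (hκ : AEMeasurable κ P) (hf : Integrable f (P.bind κ)) :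
    (fun ω => ∫ x, f x ∂κ ω) =ᵐ[P] fun ω =>
      (∫⁻ x, ENNReal.ofReal (f x) ∂κ ω).toReal - (∫⁻ x, ENNReal.ofReal (-f x) ∂κ ω).toReal := by
  filter_upwards [ae_integrable hκ hf] with ω hω
  exact integral_eq_lintegral_pos_part_sub_lintegral_neg_part hω

theorem integrable_toReal_lintegral (hκ : AEMeasurable κ P) {g : X → ℝ≥0∞}
    (hg : AEMeasurable g (P.bind κ)) (hfin : ∫⁻ x, g x ∂(P.bind κ) ≠ ∞) :
    Integrable (fun ω => (∫⁻ x, g x ∂κ ω).toReal) P ∧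
      ∫ ω, (∫⁻ x, g x ∂κ ω).toReal ∂P = (∫⁻ x, g x ∂(P.bind κ)).toReal := by
  rw [Measure.lintegral_bind hκ hg] at hfin ⊢
  have hm := aemeasurable_lintegral hκ hg
  exact ⟨integrable_toReal_of_lintegral_ne_top hm hfin, integral_toReal hm (ae_lt_top' hm hfin)⟩

theorem integrable_integral (hκ : AEMeasurable κ P) (hf : Integrable f (P.bind κ)) :
    Integrable (fun ω => ∫ x, f x ∂κ ω) P :=
  ((integrable_toReal_lintegral hκ hf.aemeasurable.ennreal_ofReal
    hf.lintegral_lt_top.ne).1.sub (integrable_toReal_lintegral hκ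
      hf.aemeasurable.neg.ennreal_ofReal hf.neg.lintegral_lt_top.ne).1).congr
    (integral_ae_eq hκ hf).symm

theorem integral_integral_eq (hκ : AEMeasurable κ P) (hf : Integrable f (P.bind κ)) :
    ∫ ω, ∫ x, f x ∂κ ω ∂P = ∫ x, f x ∂(P.bind κ) := by
  obtain ⟨h1, h1'⟩ := integrable_toReal_lintegral hκ hf.aemeasurable.ennreal_ofReal
    hf.lintegral_lt_top.ne
  obtain ⟨h2, h2'⟩ := integrable_toReal_lintegral hκ hf.aemeasurable.neg.ennreal_ofReal
    hf.neg.lintegral_lt_top.ne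
  rw [integral_congr_ae (integral_ae_eq hκ hf),
    integral_eq_lintegral_pos_part_sub_lintegral_neg_part hf, ← h1']
  exact (integral_sub h1 h2).trans (congrArg _ h2')

theorem lintegral_enorm_integral_le (hκ : AEMeasurable κ P) (hf : Integrable f (P.bind κ)) :
    ∫⁻ ω, ‖∫ x, f x ∂κ ω‖ₑ ∂P ≤ ∫⁻ x, ‖f x‖ₑ ∂(P.bind κ) := by
  rw [Measure.lintegral_bind hκ hf.aestronglyMeasurable.enorm]
  exact lintegral_mono fun ω => enorm_integral_le_lintegral_enorm _

theorem integrable_real (hκ : AEMeasurable κ P) {A : Set X} (hA : MeasurableSet A)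
    (hfin : P.bind κ A ≠ ∞) : Integrable (fun ω => (κ ω).real A) P :=
  integrable_toReal_of_lintegral_ne_top (aemeasurable_apply hκ hA)
    (by rwa [← Measure.bind_apply hA hκ])

theorem lintegral_enorm_real (hκ : AEMeasurable κ P) {A : Set X} (hA : MeasurableSet A)
    (hfin : P.bind κ A ≠ ∞) : ∫⁻ ω, ‖(κ ω).real A‖ₑ ∂P = P.bind κ A := by
  rw [Measure.bind_apply hA hκ]
  refine lintegral_congr_ae ?_
  filter_upwards [ae_apply_lt_top hκ hA hfin] with ω hω
  rw [Measure.real, Real.enorm_of_nonneg ENNReal.toReal_nonneg, ENNReal.ofReal_toReal hω.ne]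

/-- The difference is the mass of A \ A', so its ℒ¹-norm depends on `κ` only through the intensity.
This makes all later approximations of sets uniform in k. -/
theorem lintegral_enorm_real_sub (hκ : AEMeasurable κ P) {A A' : Set X} (hA : MeasurableSet A)
    (hA' : MeasurableSet A') (hsub : A' ⊆ A) (hfin : P.bind κ A ≠ ∞) :
    ∫⁻ ω, ‖(κ ω).real A - (κ ω).real A'‖ₑ ∂P = P.bind κ (A \ A') := by
  rw [← lintegral_enorm_real hκ (hA.diff hA') (measure_ne_top_of_subset sdiff_subset hfin)]
  refine lintegral_congr_ae ?_
  filter_upwards [ae_apply_lt_top hκ hA hfin] with ω hω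
  rw [measureReal_sdiff hsub hA' hω.ne]

end RandomMeasure

/-! ### Convergence in measure -/

section InMeasure

variable {Ω : Type*} [MeasurableSpace Ω] {P : Measure Ω}

theorem tendstoInMeasure_add [IsFiniteMeasure P] {f g : ℕ → Ω → ℝ} {f' g' : Ω → ℝ}
    (hf : TendstoInMeasure P f atTop f') (hg : TendstoInMeasure P g atTop g')
    (hfm : ∀ n, AEMeasurable (f n) P) (hgm : ∀ n, AEMeasurable (g n) P) :
    TendstoInMeasure P (fun n ω => f n ω + g n ω) atTop (fun ω => f' ω + g' ω) := by
  refine (exists_seq_tendstoInMeasure_atTop_iff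
    (fun n => ((hfm n).add (hgm n)).aestronglyMeasurable)).2 fun ns hns => ?_
  obtain ⟨a, ha, hfa⟩ := (hf.comp hns.tendsto_atTop).exists_seq_tendsto_ae
  obtain ⟨b, hb, hgb⟩ :=
    (hg.comp (hns.comp ha).tendsto_atTop).exists_seq_tendsto_ae
  refine ⟨a ∘ b, ha.comp hb, ?_⟩
  filter_upwards [hfa, hgb] with ω h1 h2
  exact (h1.comp hb.tendsto_atTop).add h2

theorem tendstoInMeasure_const_mul [IsFiniteMeasure P] {f : ℕ → Ω → ℝ} {f' : Ω → ℝ}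
    (hf : TendstoInMeasure P f atTop f') (hfm : ∀ n, AEMeasurable (f n) P) (c : ℝ) :
    TendstoInMeasure P (fun n ω => c * f n ω) atTop (fun ω => c * f' ω) := by
  refine (exists_seq_tendstoInMeasure_atTop_iff
    (fun n => ((hfm n).const_mul c).aestronglyMeasurable)).2 fun ns hns => ?_
  obtain ⟨a, ha, hfa⟩ := (hf.comp hns.tendsto_atTop).exists_seq_tendsto_ae
  refine ⟨a, ha, ?_⟩
  filter_upwards [hfa] with ω h1
  exact h1.const_mul c

/-- Limits in measure may be interchanged with approximations in ℒ¹ that are uniform in k. -/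
theorem tendstoInMeasure_of_approx {Y : ℕ → Ω → ℝ} {Z : Ω → ℝ}
    (hY : ∀ k, AEMeasurable (Y k) P) (hZ : AEMeasurable Z P)
    (h : ∀ ε : ℝ≥0∞, 0 < ε → ∃ (Y' : ℕ → Ω → ℝ) (Z' : Ω → ℝ), (∀ k, AEMeasurable (Y' k) P) ∧
      AEMeasurable Z' P ∧ TendstoInMeasure P Y' atTop Z' ∧
      (∀ k, ∫⁻ ω, ‖Y k ω - Y' k ω‖ₑ ∂P ≤ ε) ∧ ∫⁻ ω, ‖Z ω - Z' ω‖ₑ ∂P ≤ ε) :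
    TendstoInMeasure P Y atTop Z := by
  refine tendstoInMeasure_iff_enorm.2 fun δ hδ hδ' => ENNReal.tendsto_atTop_zero.2 fun η hη => ?_
  have hδ3 : δ / 3 ≠ 0 := (ENNReal.div_pos hδ.ne' (by simp)).ne'
  have hδ3' : δ / 3 ≠ ∞ := ENNReal.div_ne_top hδ' (by simp)
  have hη3 : 0 < η / 3 := ENNReal.div_pos hη.ne' (by simp)
  -- With this bound Markov's inequality at level δ/3 gives probability at most η/3.
  obtain ⟨Y', Z', hY', hZ', hlim, h1, h2⟩ := h (η / 3 * (δ / 3)) (ENNReal.mul_pos hη3.ne' hδ3)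
  obtain ⟨N, hN⟩ := ENNReal.tendsto_atTop_zero.1
    (tendstoInMeasure_iff_enorm.1 hlim (δ / 3) (pos_iff_ne_zero.2 hδ3) hδ3') (η / 3) hη3
  have hmarkov : ∀ U V : Ω → ℝ, AEMeasurable U P → AEMeasurable V P →
      ∫⁻ ω, ‖U ω - V ω‖ₑ ∂P ≤ η / 3 * (δ / 3) → P {ω | δ / 3 ≤ ‖U ω - V ω‖ₑ} ≤ η / 3 := by
    intro U V hU hV hUV
    refine (meas_ge_le_lintegral_div (hU.sub hV).enorm hδ3 hδ3').trans ?_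
    exact ENNReal.div_le_of_le_mul hUV
  refine ⟨N, fun n hn => ?_⟩
  have hsub : {ω | δ ≤ ‖Y n ω - Z ω‖ₑ} ⊆ ({ω | δ / 3 ≤ ‖Y n ω - Y' n ω‖ₑ} ∪
      {ω | δ / 3 ≤ ‖Y' n ω - Z' ω‖ₑ}) ∪ {ω | δ / 3 ≤ ‖Z ω - Z' ω‖ₑ} := by
    intro ω hω
    by_contra hcon
    simp only [mem_union, mem_ofPred_eq, not_or, not_le] at hcon hω
    have h3 : ‖Y n ω - Z ω‖ₑ ≤ ‖Y n ω - Y' n ω‖ₑ + ‖Y' n ω - Z' ω‖ₑ + ‖Z ω - Z' ω‖ₑ := by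
      have e : Y n ω - Z ω = (Y n ω - Y' n ω) + (Y' n ω - Z' ω) + -(Z ω - Z' ω) := by ring
      rw [e]
      refine (enorm_add_le _ _).trans ?_
      rw [enorm_neg]
      gcongr
      exact enorm_add_le _ _
    refine absurd (hω.trans h3) (not_le.2 ?_)
    calc _ < δ / 3 + δ / 3 + δ / 3 :=
          ENNReal.add_lt_add (ENNReal.add_lt_add hcon.1.1 hcon.1.2) hcon.2
      _ = δ := ENNReal.add_thirds δ
  calc P {ω | δ ≤ ‖Y n ω - Z ω‖ₑ} ≤ _ := measure_mono hsub
    _ ≤ _ := measure_union_le _ _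
    _ ≤ η / 3 + η / 3 + η / 3 := by
      refine add_le_add ((measure_union_le _ _).trans (add_le_add ?_ (hN n hn))) ?_
      · exact hmarkov _ _ (hY n) (hY' n) (h1 n)
      · exact hmarkov _ _ hZ hZ' h2
    _ = η := ENNReal.add_thirds η

/-- Countably many sequences that converge in measure converge almost everywhere along a common
subsequence. -/
theorem exists_common_seq_tendsto_ae {Y : ℕ → ℕ → Ω → ℝ} {Z : ℕ → Ω → ℝ}
    (h : ∀ j, TendstoInMeasure P (Y j) atTop (Z j)) :
    ∃ ns : ℕ → ℕ, StrictMono ns ∧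
      ∀ᵐ ω ∂P, ∀ j, Tendsto (fun i => Y j (ns i) ω) atTop (𝓝 (Z j ω)) := by
  -- Diagonal choice: the n-th index serves the sequences 0, …, n at once with error 2⁻ⁿ, and
  -- Borel–Cantelli applies to each.
  have hev : ∀ n, ∀ᶠ k in atTop, ∀ j ≤ n,
      P {ω | (2 : ℝ≥0∞)⁻¹ ^ n ≤ edist (Y j k ω) (Z j ω)} ≤ (2 : ℝ≥0∞)⁻¹ ^ n := by
    intro n
    refine (eventually_all_finite (finite_Iic n)).2 fun j _ => ?_
    have hp : (0 : ℝ≥0∞) < 2⁻¹ ^ n := ENNReal.pow_pos (by simp) n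
    exact (h j _ hp).eventually_le_const hp
  obtain ⟨ns, hns, hP⟩ := extraction_forall_of_eventually hev
  refine ⟨ns, hns, ae_all_iff.2 fun j => ?_⟩
  -- The shift by j is needed because the j-th sequence is controlled only from the j-th index on.
  have hsum : ∑' n, P {ω | (2 : ℝ≥0∞)⁻¹ ^ (n + j) ≤ edist (Y j (ns (n + j)) ω) (Z j ω)} ≠ ∞ := by
    refine ne_top_of_le_ne_top ?_ (ENNReal.tsum_le_tsum (g := fun n => (2 : ℝ≥0∞)⁻¹ ^ n)
      fun n => (hP (n + j) j le_add_self).trans ?_)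
    · rw [ENNReal.tsum_geometric]
      simp
    · exact pow_le_pow_right_of_le_one' (by simp) le_self_add
  filter_upwards [ae_eventually_notMem hsum] with ω hω
  refine (tendsto_add_atTop_iff_nat j).1 (tendsto_iff_edist_tendsto_0.2 ?_)
  have hlim : Tendsto (fun n => (2 : ℝ≥0∞)⁻¹ ^ (n + j)) atTop (𝓝 0) :=
    (tendsto_add_atTop_iff_nat j).2 (ENNReal.tendsto_pow_atTop_nhds_zero_of_lt_one (by simp))
  refine tendsto_of_tendsto_of_tendsto_of_le_of_le' tendsto_const_nhds hlim
    (Eventually.of_forall fun _ => zero_le) ?_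
  filter_upwards [hω] with n hn
  exact (not_le.1 hn).le

end InMeasure

section Sets

variable {X Ω : Type*} [MeasurableSpace X] [MeasurableSpace Ω] {P : Measure Ω}

/-- Convergence in probability of random measures on all sets of finite intensity implies the
convergence in probability of the integrals of all functions integrable for the intensity. -/
theorem tendstoInMeasure_integral [IsFiniteMeasure P] {m : Measure X} {κ : ℕ → Ω → Measure X}
    {κ' : Ω → Measure X} (hκ : ∀ k, AEMeasurable (κ k) P) (hκ' : AEMeasurable κ' P)
    (hle : ∀ k, P.bind (κ k) ≤ m) (hle' : P.bind κ' ≤ m)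
    (hset : ∀ A, MeasurableSet A → m A < ∞ → TendstoInMeasure P (fun k ω => (κ k ω).real A) atTop
      (fun ω => (κ' ω).real A)) {f : X → ℝ} (hf : Integrable f m) :
    TendstoInMeasure P (fun k ω => ∫ x, f x ∂(κ k ω)) atTop (fun ω => ∫ x, f x ∂(κ' ω)) := by
  have hm : ∀ g : X → ℝ, Integrable g m → ∀ k, AEMeasurable (fun ω => ∫ x, g x ∂(κ k ω)) P :=
    fun g hg k => (integrable_integral (hκ k) (hg.mono_measure (hle k))).aemeasurable
  have hm' : ∀ g : X → ℝ, Integrable g m → AEMeasurable (fun ω => ∫ x, g x ∂(κ' ω)) P :=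
    fun g hg => (integrable_integral hκ' (hg.mono_measure hle')).aemeasurable
  -- As the intensities are at most m, g ↦ ∫ g dσ is a contraction from L¹(m) to L¹(P), uniformly in
  -- σ; this gives closedness in the induction below.
  have hdist : ∀ {σ : Ω → Measure X}, AEMeasurable σ P → P.bind σ ≤ m → ∀ g g' : X → ℝ,
      Integrable g m → Integrable g' m →
      ∫⁻ ω, ‖∫ x, g x ∂(σ ω) - ∫ x, g' x ∂(σ ω)‖ₑ ∂P ≤ ∫⁻ x, ‖g x - g' x‖ₑ ∂m := by
    intro σ hσ hσm g g' hg hg'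
    have h1 := lintegral_enorm_integral_le hσ ((hg.sub hg').mono_measure hσm)
    refine le_trans (le_of_eq (lintegral_congr_ae ?_)) (h1.trans (lintegral_mono' hσm le_rfl))
    filter_upwards [ae_integrable hσ (hg.mono_measure hσm),
      ae_integrable hσ (hg'.mono_measure hσm)] with ω h2 h3
    simp only [Pi.sub_apply]
    rw [integral_sub h2 h3]
  refine Integrable.induction (fun f : X → ℝ => TendstoInMeasure P
    (fun k ω => ∫ x, f x ∂(κ k ω)) atTop (fun ω => ∫ x, f x ∂(κ' ω))) ?_ ?_ ?_ ?_ hf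
  · intro c A hA hAm
    have h1 := tendstoInMeasure_const_mul (hset A hA hAm) (fun k => aemeasurable_real (hκ k) hA) c
    simpa only [integral_indicator_const _ hA, smul_eq_mul, mul_comm] using h1
  · intro g g' _ hg hg' h1 h2
    refine (tendstoInMeasure_add h1 h2 (hm g hg) (hm g' hg')).congr (fun k => ?_) ?_
    · filter_upwards [ae_integrable (hκ k) (hg.mono_measure (hle k)),
        ae_integrable (hκ k) (hg'.mono_measure (hle k))] with ω h3 h4
      exact (integral_add h3 h4).symm
    · filter_upwards [ae_integrable hκ' (hg.mono_measure hle'),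
        ae_integrable hκ' (hg'.mono_measure hle')] with ω h3 h4
      exact (integral_add h3 h4).symm
  · refine isClosed_of_closure_subset fun g hg => ?_
    have hgi := L1.integrable_coeFn g
    refine tendstoInMeasure_of_approx (hm g hgi) (hm' g hgi) fun ε hε => ?_
    obtain ⟨g', hg', hlt⟩ := EMetric.mem_closure_iff.1 hg ε hε
    have hgi' := L1.integrable_coeFn g'
    have hE : ∫⁻ x, ‖g x - g' x‖ₑ ∂m ≤ ε := by
      rw [Lp.edist_def, eLpNorm_one_eq_lintegral_enorm] at hlt
      exact hlt.le
    exact ⟨_, _, hm g' hgi', hm' g' hgi', hg',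
      fun k => (hdist (hκ k) (hle k) g g' hgi hgi').trans hE,
      (hdist hκ' hle' g g' hgi hgi').trans hE⟩
  · intro g g' hgg' hg h1
    have hae : ∀ {σ : Ω → Measure X}, AEMeasurable σ P → P.bind σ ≤ m →
        (fun ω => ∫ x, g x ∂(σ ω)) =ᵐ[P] fun ω => ∫ x, g' x ∂(σ ω) := by
      intro σ hσ hσm
      filter_upwards [Measure.ae_ae_of_ae_bind hσ (ae_mono hσm hgg')] with ω hω
      exact integral_congr_ae hω
    exact h1.congr (fun k => hae (hκ k) (hle k)) (hae hκ' hle')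

end Sets

/-! ### Weak convergence -/

section Weak

variable {X Ω : Type*} [MetricSpace X] [MeasurableSpace X] [BorelSpace X] [MeasurableSpace Ω]

/-- Portmanteau for varying total masses: the open-set condition gives lower bounds for integrals of
nonnegative continuous functions, and it is used for ‖f‖ + f and ‖f‖ - f. -/
theorem weaklyConverges_of_isOpen {m : ℕ → Measure X} {μ : Measure X} [∀ k, IsFiniteMeasure (m k)]
    [IsFiniteMeasure μ] (huniv : Tendsto (fun k => (m k).real univ) atTop (𝓝 (μ.real univ)))
    (hopen : ∀ G, IsOpen G → μ G ≤ liminf (fun k => m k G) atTop) : WeaklyConverges m μ := by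
  have key : ∀ h : X → ℝ, Continuous h → (∀ x, 0 ≤ h x) → (∀ k, Integrable h (m k)) →
      Integrable h μ → ∀ a, a < ∫ x, h x ∂μ → ∀ᶠ k in atTop, a < ∫ x, h x ∂(m k) := by
    intro h hc h0 hint hint' a ha
    rcases lt_or_ge a 0 with ha0 | ha0
    · exact Eventually.of_forall fun k => ha0.trans_le (integral_nonneg h0)
    · have h1 := lintegral_le_liminf_lintegral_of_forall_isOpen_measure_le_liminf_measure hc h0 hopen
      rw [← ofReal_integral_eq_lintegral_ofReal hint' (Eventually.of_forall h0)] at h1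
      have h2 : ENNReal.ofReal a < ENNReal.ofReal (∫ x, h x ∂μ) :=
        (ENNReal.ofReal_lt_ofReal_iff (ha0.trans_lt ha)).2 ha
      filter_upwards [eventually_lt_of_lt_liminf (h2.trans_le h1)] with k hk
      rw [← ofReal_integral_eq_lintegral_ofReal (hint k) (Eventually.of_forall h0)] at hk
      exact (ENNReal.ofReal_lt_ofReal_iff_of_nonneg ha0).1 hk
  intro f
  have hb : ∀ x, |f x| ≤ ‖f‖ := fun x => f.norm_coe_le_norm x
  have hi : ∀ σ : Measure X, IsFiniteMeasure σ → Integrable f σ := fun σ hσ => f.integrable σ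
  have hadd : ∀ σ : Measure X, IsFiniteMeasure σ →
      ∫ x, (‖f‖ + f x) ∂σ = ‖f‖ * σ.real univ + ∫ x, f x ∂σ := fun σ hσ => by
    rw [integral_add (integrable_const _) (hi σ hσ), integral_const, smul_eq_mul, mul_comm]
  have hsub : ∀ σ : Measure X, IsFiniteMeasure σ →
      ∫ x, (‖f‖ - f x) ∂σ = ‖f‖ * σ.real univ - ∫ x, f x ∂σ := fun σ hσ => by
    rw [integral_sub (integrable_const _) (hi σ hσ), integral_const, smul_eq_mul, mul_comm]
  have hu := huniv.const_mul ‖f‖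
  refine tendsto_order.2 ⟨fun a ha => ?_, fun a ha => ?_⟩
  · obtain ⟨b, hab, hb'⟩ := exists_between ha
    have h1 := key (fun x => ‖f‖ + f x) (by fun_prop)
      (fun x => by linarith [neg_abs_le (f x), hb x])
      (fun k => (integrable_const _).add (hi _ inferInstance))
      ((integrable_const _).add (hi _ inferInstance)) (‖f‖ * μ.real univ + b)
      (by rw [hadd μ inferInstance]; linarith)
    filter_upwards [h1, hu.eventually_lt_const (u := ‖f‖ * μ.real univ + (b - a)) (by linarith)]
      with k hk1 hk2
    rw [hadd _ inferInstance] at hk1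
    linarith
  · obtain ⟨b, hab, hb'⟩ := exists_between ha
    have h1 := key (fun x => ‖f‖ - f x) (by fun_prop)
      (fun x => by linarith [le_abs_self (f x), hb x])
      (fun k => (integrable_const _).sub (hi _ inferInstance))
      ((integrable_const _).sub (hi _ inferInstance)) (‖f‖ * μ.real univ - b)
      (by rw [hsub μ inferInstance]; linarith)
    filter_upwards [h1, hu.eventually_lt_const (u := ‖f‖ * μ.real univ + (a - b)) (by linarith)]
      with k hk1 hk2
    rw [hsub _ inferInstance] at hk1
    linarith

/-- Finite unions of basic open sets. They reduce the open-set condition for all open sets to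
countably many, independently of the measure, so that null sets can be collected. -/
theorem exists_seq_isOpen_iSup (X : Type*) [TopologicalSpace X] [SecondCountableTopology X]
    [MeasurableSpace X] [OpensMeasurableSpace X] :
    ∃ U : ℕ → Set X, (∀ n, IsOpen (U n)) ∧ ∀ (μ : Measure X) (G : Set X), IsOpen G →
      μ G ≤ ⨆ n ∈ {n | U n ⊆ G}, μ (U n) := by
  have hbc := TopologicalSpace.countable_countableBasis X
  have hb := TopologicalSpace.isBasis_countableBasis X
  set b := TopologicalSpace.countableBasis X
  have hc : {s : Set (Set X) | s.Finite ∧ s ⊆ b}.Countable :=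
    Set.countable_ofPred_finite_subset hbc
  obtain ⟨s, hs⟩ := hc.exists_eq_range ⟨∅, finite_empty, empty_subset _⟩
  have hs' : ∀ n, (s n).Finite ∧ s n ⊆ b := fun n => by
    have : s n ∈ {s : Set (Set X) | s.Finite ∧ s ⊆ b} := hs ▸ mem_range_self n
    exact this
  refine ⟨fun n => ⋃₀ s n, fun n => isOpen_sUnion fun u hu => hb.isOpen ((hs' n).2 hu),
    fun μ G hG => ?_⟩
  have hd : DirectedOn (Function.onFun (· ⊆ ·) fun n => ⋃₀ s n) {n | ⋃₀ s n ⊆ G} := by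
    intro i hi j hj
    have : s i ∪ s j ∈ range s := hs ▸ ⟨(hs' i).1.union (hs' j).1, union_subset (hs' i).2 (hs' j).2⟩
    obtain ⟨n, hn⟩ := this
    refine ⟨n, ?_, ?_, ?_⟩
    · simp only [mem_ofPred_eq, hn, sUnion_union]
      exact union_subset hi hj
    · simp only [Function.onFun, hn, sUnion_union]
      exact subset_union_left
    · simp only [Function.onFun, hn, sUnion_union]
      exact subset_union_right
  rw [← measure_biUnion_eq_iSup (to_countable _) hd]
  refine measure_mono fun x hx => ?_
  obtain ⟨u, hu, hxu, huG⟩ := hb.exists_subset_of_mem_open hx hG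
  have : {u} ∈ range s := hs ▸ ⟨finite_singleton u, singleton_subset_iff.2 hu⟩
  obtain ⟨n, hn⟩ := this
  refine mem_biUnion (x := n) ?_ ?_
  · simp only [mem_ofPred_eq, hn, sUnion_singleton]
    exact huG
  · simp only [hn, sUnion_singleton]
    exact hxu

theorem weaklyConvergesSubseq_of_isOpen [SecondCountableTopology X] {P : Measure Ω}
    {m : ℕ → Ω → Measure X} {μ : Ω → Measure X} (hm : ∀ k, ∀ᵐ ω ∂P, IsFiniteMeasure (m k ω))
    (hμ : ∀ᵐ ω ∂P, IsFiniteMeasure (μ ω))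
    (h : ∀ G, IsOpen G → TendstoInMeasure P (fun k ω => (m k ω).real G) atTop
      (fun ω => (μ ω).real G)) : WeaklyConvergesSubseq P m μ := by
  intro α hα
  obtain ⟨U, hU, hUG⟩ := exists_seq_isOpen_iSup X
  -- The whole space is put at index 0 to control total masses, hence the index n + 1 for `U n`
  -- below.
  let V : ℕ → Set X := fun n => Nat.casesOn n univ U
  have hV : ∀ n, IsOpen (V n) := fun n => by
    cases n with
    | zero => exact isOpen_univ
    | succ n => exact hU n
  obtain ⟨β, hβ, hlim⟩ := exists_common_seq_tendsto_ae
    (fun j => (h (V j) (hV j)).comp hα.tendsto_atTop)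
  refine ⟨β, hβ, ?_⟩
  filter_upwards [hlim, hμ, ae_all_iff.2 hm] with ω hω h1 h2
  refine weaklyConverges_of_isOpen (hω 0) fun G hG => (hUG _ G hG).trans (iSup₂_le fun n hn => ?_)
  have h3 : Tendsto (fun k => m (α (β k)) ω (U n)) atTop (𝓝 (μ ω (U n))) :=
    (ENNReal.tendsto_toReal_iff (fun k => measure_ne_top _ _) (measure_ne_top _ _)).1 (hω (n + 1))
  rw [← h3.liminf_eq]
  exact liminf_le_liminf (Eventually.of_forall fun k => measure_mono hn)

end Weak

/-! ### The approximating random measures -/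

section Weight

variable {X Ω : Type*} [MetricSpace X] [MeasurableSpace Ω] {P : Measure Ω}
  {𝒬 : ℕ → Set (Set X)} {B : Ω → Set X} {k : ℕ}

open Classical in
theorem measurable_hitWeight (hB : IsRandomClosedSet P 𝒬 B) (Q : 𝒬 k) :
    Measurable fun ω =>
      if ω ∈ hitEvent B (Q : Set X) then (P (hitEvent B (Q : Set X)))⁻¹ else 0 :=
  Measurable.ite (hB.measurableSet_hit k Q Q.2) measurable_const measurable_const

open Classical in
theorem lintegral_hitWeight [IsFiniteMeasure P] (hB : IsRandomClosedSet P 𝒬 B) (Q : 𝒬 k) :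
    ∫⁻ ω, (if ω ∈ hitEvent B (Q : Set X) then (P (hitEvent B (Q : Set X)))⁻¹ else 0) ∂P = 1 := by
  have h : (fun ω => if ω ∈ hitEvent B (Q : Set X) then (P (hitEvent B (Q : Set X)))⁻¹ else 0) =
      (hitEvent B (Q : Set X)).indicator fun _ => (P (hitEvent B (Q : Set X)))⁻¹ := by
    ext ω
    rw [indicator_apply]
  rw [h, lintegral_indicator_const (hB.measurableSet_hit k Q Q.2),
    ENNReal.inv_mul_cancel (hB.hit_pos k Q Q.2).ne' (measure_ne_top _ _)]

end Weight

section Approx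

variable {X Ω : Type*} [MeasurableSpace X] [MeasurableSpace Ω] {P : Measure Ω}
  {𝒬 : ℕ → Set (Set X)} {B : Ω → Set X} {ν τ : Measure X} {k : ℕ} {ω : Ω}

open Classical in
theorem condApprox_apply {A : Set X} (hA : MeasurableSet A) :
    condApprox P 𝒬 B ν k ω A = ∑' Q : 𝒬 k,
      (if ω ∈ hitEvent B (Q : Set X) then (P (hitEvent B (Q : Set X)))⁻¹ else 0) *
        ν.restrict (Q : Set X) A := by
  rw [condApprox, Measure.sum_apply _ hA]
  rfl

theorem condApprox_add : condApprox P 𝒬 B (ν + τ) k ω =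
    condApprox P 𝒬 B ν k ω + condApprox P 𝒬 B τ k ω := by
  simp only [condApprox, Measure.restrict_add, smul_add]
  exact (Measure.sum_add_sum _ _).symm

theorem condApprox_absolutelyContinuous : condApprox P 𝒬 B ν k ω ≪ ν :=
  Measure.absolutelyContinuous_sum_left fun _ =>
    (Measure.absolutelyContinuous_of_le Measure.restrict_le_self).smul_left _

variable [MetricSpace X]

theorem measurable_condApprox (h𝒬 : IsNestedSequence 𝒬) (hB : IsRandomClosedSet P 𝒬 B)
    (ν : Measure X) (k : ℕ) : Measurable (condApprox P 𝒬 B ν k) := by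
  have := (h𝒬.countable k).to_subtype
  refine Measure.measurable_of_measurable_coe _ fun A hA => ?_
  simp only [condApprox_apply hA]
  exact Measurable.tsum fun Q => (measurable_hitWeight hB Q).mul_const _

/-- Each weight has expectation 1, and the disjoint cells of generation k cover ν-almost everything.
-/
theorem bind_condApprox [IsFiniteMeasure P] (h𝒬 : IsNestedSequence 𝒬)
    (hB : IsRandomClosedSet P 𝒬 B) (hν : ν (coveredSet 𝒬)ᶜ = 0) (k : ℕ) :
    P.bind (condApprox P 𝒬 B ν k) = ν := by
  have := (h𝒬.countable k).to_subtype
  ext A hA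
  rw [Measure.bind_apply hA (measurable_condApprox h𝒬 hB ν k).aemeasurable]
  simp only [condApprox_apply hA]
  rw [lintegral_tsum fun Q => ((measurable_hitWeight hB Q).mul_const _).aemeasurable]
  have h1 : ∀ Q : 𝒬 k, ∫⁻ ω, (open Classical in
      (if ω ∈ hitEvent B (Q : Set X) then (P (hitEvent B (Q : Set X)))⁻¹ else 0) *
        ν.restrict (Q : Set X) A) ∂P = ν.restrict (Q : Set X) A := fun Q => by
    rw [lintegral_mul_const _ (measurable_hitWeight hB Q), lintegral_hitWeight hB Q, one_mul]
  rw [tsum_congr h1, ← Measure.sum_apply _ hA, ← Measure.restrict_iUnion, ← sUnion_eq_iUnion]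
  · refine congrArg (fun m : Measure X => m A) (Measure.restrict_eq_self_of_ae_mem ?_)
    refine measure_mono_null (compl_subset_compl.2 fun x hx => ?_) hν
    rw [sUnion_eq_biUnion]
    exact mem_iInter.1 hx k
  · intro Q S hQS
    exact disjoint_iff_inter_eq_empty.2
      (h𝒬.disjoint k Q Q.2 S S.2 fun h => hQS (Subtype.ext h))
  · exact fun Q => h𝒬.measurableSet k Q Q.2

theorem condApprox_withDensity (h𝒬 : IsNestedSequence 𝒬) (g : X → ℝ≥0∞) :
    condApprox P 𝒬 B (ν.withDensity g) k ω = (condApprox P 𝒬 B ν k ω).withDensity g := by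
  simp only [condApprox]
  rw [withDensity_sum]
  congr 1
  ext1 Q
  rw [withDensity_smul_measure, restrict_withDensity (h𝒬.measurableSet k Q Q.2)]

/-- A cell with positive weight meets B and has diameter below r, so it cannot reach U. -/
theorem condApprox_eq_zero_of_far {U : Set X} (hU : MeasurableSet U) {r : ℝ≥0∞}
    (hdiam : ∀ Q ∈ 𝒬 k, Metric.ediam Q < r) (hfar : ∀ x ∈ U, ∀ y ∈ B ω, r ≤ edist x y) :
    condApprox P 𝒬 B ν k ω U = 0 := by
  classical
  rw [condApprox_apply hU, ENNReal.tsum_eq_zero]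
  intro Q
  split_ifs with h
  · obtain ⟨y, hyB, hyQ⟩ := h
    rw [Measure.restrict_apply hU, show U ∩ (Q : Set X) = ∅ from ?_, measure_empty, mul_zero]
    refine eq_empty_of_forall_notMem fun x hx => ?_
    exact absurd ((Metric.edist_le_ediam_of_mem hx.2 hyQ).trans_lt (hdiam Q Q.2))
      (not_lt.2 (hfar x hx.1 y hyB))
  · rw [zero_mul]

theorem eventually_ediam_lt (h𝒬 : IsNestedSequence 𝒬) {r : ℝ≥0∞} (hr : 0 < r) :
    ∀ᶠ k in atTop, ∀ Q ∈ 𝒬 k, Metric.ediam Q < r := by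
  filter_upwards [h𝒬.tendsto_diam.eventually_lt_const hr] with k hk Q hQ
  exact (le_iSup₂ (f := fun Q (_ : Q ∈ 𝒬 k) => Metric.ediam Q) Q hQ).trans_lt hk

end Approx

/-! ### Limits in `ℒ¹` of random measures -/

section L1

variable {X Ω : Type*} [MeasurableSpace X] [MeasurableSpace Ω] {P : Measure Ω}

theorem exists_convergesInL1To {Y : ℕ → Ω → ℝ} (hY : ∀ k, Integrable (Y k) P)
    (hc : ∀ ε : ℝ≥0∞, 0 < ε → ∃ N, ∀ i ≥ N, ∀ j ≥ N, ∫⁻ ω, ‖Y i ω - Y j ω‖ₑ ∂P < ε) :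
    ∃ Z, ConvergesInL1To P Y Z := by
  have hcau : CauchySeq fun k => (hY k).toL1 (Y k) := by
    refine EMetric.cauchySeq_iff.2 fun ε hε => ?_
    obtain ⟨N, hN⟩ := hc ε hε
    refine ⟨N, fun i hi j hj => ?_⟩
    rw [Integrable.edist_toL1_toL1]
    simpa only [edist_eq_enorm_sub] using hN i hi j hj
  obtain ⟨Z, hZ⟩ := cauchySeq_tendsto_of_complete hcau
  refine ⟨Z, hY, L1.integrable_coeFn Z, ?_⟩
  refine (tendsto_iff_edist_tendsto_0.1 hZ).congr fun k => ?_
  conv_lhs => rw [← Integrable.toL1_coeFn Z (L1.integrable_coeFn Z)]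
  rw [Integrable.edist_toL1_toL1]
  simp only [edist_eq_enorm_sub]

theorem ConvergesInL1To.tendstoInMeasure {Y : ℕ → Ω → ℝ} {Z : Ω → ℝ}
    (h : ConvergesInL1To P Y Z) : TendstoInMeasure P Y atTop Z := by
  refine tendstoInMeasure_of_tendsto_eLpNorm (p := 1) one_ne_zero
    (fun k => (h.1 k).aestronglyMeasurable) h.2.1.aestronglyMeasurable ?_
  simp only [eLpNorm_one_eq_lintegral_enorm, Pi.sub_apply]
  exact h.2.2

theorem ConvergesInL1To.congr {Y Y' : ℕ → Ω → ℝ} {Z Z' : Ω → ℝ}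
    (h : ConvergesInL1To P Y Z) (hY : ∀ k, Y k =ᵐ[P] Y' k) (hZ : Z =ᵐ[P] Z') :
    ConvergesInL1To P Y' Z' := by
  refine ⟨fun k => (h.1 k).congr (hY k), h.2.1.congr hZ, h.2.2.congr fun k => ?_⟩
  refine lintegral_congr_ae ?_
  filter_upwards [hY k, hZ] with ω h1 h2
  rw [h1, h2]

theorem ConvergesInL1To.add {Y Y' : ℕ → Ω → ℝ} {Z Z' : Ω → ℝ}
    (h : ConvergesInL1To P Y Z) (h' : ConvergesInL1To P Y' Z') :
    ConvergesInL1To P (fun k ω => Y k ω + Y' k ω) (fun ω => Z ω + Z' ω) := by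
  refine ⟨fun k => (h.1 k).add (h'.1 k), h.2.1.add h'.2.1, ?_⟩
  have hs := h.2.2.add h'.2.2
  rw [add_zero] at hs
  refine tendsto_of_tendsto_of_tendsto_of_le_of_le tendsto_const_nhds hs (fun _ => zero_le)
    fun k => ?_
  dsimp only
  have hm : AEMeasurable (fun ω => ‖Y k ω - Z ω‖ₑ) P :=
    ((h.1 k).sub h.2.1).aestronglyMeasurable.enorm
  rw [← lintegral_add_left' hm]
  refine lintegral_mono fun ω => ?_
  rw [add_sub_add_comm]
  exact enorm_add_le _ _

variable {κ : ℕ → Ω → Measure X} {m : Measure X}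

theorem convergesInL1To_union (hκ : ∀ k, AEMeasurable (κ k) P)
    (hbind : ∀ k, P.bind (κ k) = m) {A A' : Set X} (hA : MeasurableSet A)
    (hA' : MeasurableSet A') (hd : Disjoint A A') (hAm : m A ≠ ∞) (hAm' : m A' ≠ ∞)
    {Z Z' : Ω → ℝ} (h : ConvergesInL1To P (fun k ω => (κ k ω).real A) Z)
    (h' : ConvergesInL1To P (fun k ω => (κ k ω).real A') Z') :
    ConvergesInL1To P (fun k ω => (κ k ω).real (A ∪ A')) (fun ω => Z ω + Z' ω) := by
  refine (h.add h').congr (fun k => ?_) EventuallyEq.rfl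
  filter_upwards [ae_apply_lt_top (hκ k) hA (by rwa [hbind k]),
    ae_apply_lt_top (hκ k) hA' (by rwa [hbind k])] with ω h1 h2
  exact (measureReal_union hd hA' h1.ne h2.ne).symm

/-- Replacing A by A' costs m(A \ A') for every k, so the sequence for A is Cauchy in ℒ¹. -/
theorem exists_convergesInL1To_of_approx (hκ : ∀ k, AEMeasurable (κ k) P)
    (hbind : ∀ k, P.bind (κ k) = m) {A : Set X} (hA : MeasurableSet A) (hAm : m A ≠ ∞)
    (h : ∀ ε : ℝ≥0∞, 0 < ε → ∃ A' ⊆ A, MeasurableSet A' ∧ m (A \ A') < ε ∧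
      ∃ Z, ConvergesInL1To P (fun k ω => (κ k ω).real A') Z) :
    ∃ Z, ConvergesInL1To P (fun k ω => (κ k ω).real A) Z := by
  refine exists_convergesInL1To (fun k => integrable_real (hκ k) hA (by rwa [hbind k]))
    fun ε hε => ?_
  have hε4 : 0 < ε / 2 / 2 := ENNReal.half_pos (ENNReal.half_pos hε.ne').ne'
  obtain ⟨A', hsub, hA', hlt, Z, hZ⟩ := h (ε / 2 / 2) hε4
  obtain ⟨N, hN⟩ := ((hZ.2.2).eventually_lt_const hε4).exists_forall_of_atTop
  have hbound : ∀ i ≥ N, ∫⁻ ω, ‖(κ i ω).real A - Z ω‖ₑ ∂P < ε / 2 := by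
    intro i hi
    have hm : AEMeasurable (fun ω => ‖(κ i ω).real A - (κ i ω).real A'‖ₑ) P :=
      ((aemeasurable_real (hκ i) hA).sub (aemeasurable_real (hκ i) hA')).enorm
    calc ∫⁻ ω, ‖(κ i ω).real A - Z ω‖ₑ ∂P
        ≤ ∫⁻ ω, (‖(κ i ω).real A - (κ i ω).real A'‖ₑ + ‖(κ i ω).real A' - Z ω‖ₑ) ∂P := by
          refine lintegral_mono fun ω => ?_
          rw [← sub_add_sub_cancel _ ((κ i ω).real A') (Z ω)]
          exact enorm_add_le _ _
      _ = m (A \ A') + ∫⁻ ω, ‖(κ i ω).real A' - Z ω‖ₑ ∂P := by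
          rw [lintegral_add_left' hm, lintegral_enorm_real_sub (hκ i) hA hA' hsub
            (by rwa [hbind i]), hbind i]
      _ < ε / 2 / 2 + ε / 2 / 2 := ENNReal.add_lt_add hlt (hN i hi)
      _ = ε / 2 := ENNReal.add_halves _
  refine ⟨N, fun i hi j hj => ?_⟩
  have hm : AEMeasurable (fun ω => ‖(κ i ω).real A - Z ω‖ₑ) P :=
    ((aemeasurable_real (hκ i) hA).sub hZ.2.1.aemeasurable).enorm
  calc ∫⁻ ω, ‖(κ i ω).real A - (κ j ω).real A‖ₑ ∂P
      ≤ ∫⁻ ω, (‖(κ i ω).real A - Z ω‖ₑ + ‖(κ j ω).real A - Z ω‖ₑ) ∂P := by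
        refine lintegral_mono fun ω => ?_
        rw [← sub_sub_sub_cancel_right _ _ (Z ω)]
        exact enorm_sub_le
    _ < ε / 2 + ε / 2 := by
        rw [lintegral_add_left' hm]
        exact ENNReal.add_lt_add (hbound i hi) (hbound j hj)
    _ = ε := ENNReal.add_halves _

theorem ConvergesInL1To.nonneg {Y : ℕ → Ω → ℝ} {Z : Ω → ℝ} (h : ConvergesInL1To P Y Z)
    (hY : ∀ k ω, 0 ≤ Y k ω) : 0 ≤ᵐ[P] Z := by
  obtain ⟨ns, -, hns⟩ := h.tendstoInMeasure.exists_seq_tendsto_ae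
  filter_upwards [hns] with ω hω
  exact ge_of_tendsto' hω fun i => hY _ _

/-- Random measures with common intensity that converge in `ℒ¹` on each set of finite intensity
have a random measure as their limit. -/
theorem exists_randomMeasure_convergesInL1To [StandardBorelSpace X] [SigmaFinite m]
    (hκ : ∀ k, AEMeasurable (κ k) P) (hbind : ∀ k, P.bind (κ k) = m)
    (h : ∀ A, MeasurableSet A → m A < ∞ →
      ∃ Z, ConvergesInL1To P (fun k ω => (κ k ω).real A) Z) :
    ∃ μ : Ω → Measure X, Measurable μ ∧ P.bind μ = m ∧ ∀ A, MeasurableSet A → m A < ∞ →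
      ConvergesInL1To P (fun k ω => (κ k ω).real A) (fun ω => (μ ω).real A) := by
  choose! Z hZ using h
  have hZ0 : ∀ A, MeasurableSet A → m A < ∞ → 0 ≤ᵐ[P] Z A := fun A hA hAm =>
    (hZ A hA hAm).nonneg fun k ω => measureReal_nonneg
  -- Expectations pass to ℒ¹-limits, and those of the sequence are constantly m(A).
  have hint : ∀ A, MeasurableSet A → m A < ∞ → ∫⁻ ω, ENNReal.ofReal (Z A ω) ∂P = m A := by
    intro A hA hAm
    have h1 := tendsto_integral_of_L1 (Z A) (hZ A hA hAm).2.1.aestronglyMeasurable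
      (Eventually.of_forall (hZ A hA hAm).1) (hZ A hA hAm).2.2
    have h2 : ∀ k, ∫ ω, (κ k ω).real A ∂P = m.real A := fun k => by
      have hAk : P.bind (κ k) A < ∞ := by rwa [hbind k]
      have := integral_toReal (aemeasurable_apply (hκ k) hA) (ae_apply_lt_top (hκ k) hA hAk.ne)
      rw [← Measure.bind_apply hA (hκ k), hbind k] at this
      exact this
    simp only [h2] at h1
    rw [← ofReal_integral_eq_lintegral_ofReal (hZ A hA hAm).2.1 (hZ0 A hA hAm),
      ← tendsto_nhds_unique tendsto_const_nhds h1, Measure.real, ENNReal.ofReal_toReal hAm.ne]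
  have hadd : ∀ A A', MeasurableSet A → MeasurableSet A' → m A < ∞ → m A' < ∞ → Disjoint A A' →
      ∀ᵐ ω ∂P, ENNReal.ofReal (Z (A ∪ A') ω) =
        ENNReal.ofReal (Z A ω) + ENNReal.ofReal (Z A' ω) := by
    intro A A' hA hA' hAm hAm' hd
    have hU : m (A ∪ A') < ∞ := measure_union_lt_top hAm hAm'
    have h1 := convergesInL1To_union hκ hbind hA hA' hd hAm.ne hAm'.ne (hZ A hA hAm)
      (hZ A' hA' hAm')
    filter_upwards [tendstoInMeasure_ae_unique h1.tendstoInMeasure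
      (hZ _ (hA.union hA') hU).tendstoInMeasure, hZ0 A hA hAm, hZ0 A' hA' hAm'] with ω e1 e2 e3
    rw [← e1, ENNReal.ofReal_add e2 e3]
  obtain ⟨μ, hμ, hμb, hμA⟩ := exists_randomMeasure (M := fun A ω => ENNReal.ofReal (Z A ω))
    (fun A hA hAm => (hZ A hA hAm).2.1.aemeasurable.ennreal_ofReal) hint hadd
  refine ⟨μ, hμ, hμb, fun A hA hAm => (hZ A hA hAm).congr (fun k => EventuallyEq.rfl) ?_⟩
  filter_upwards [hμA A hA hAm, hZ0 A hA hAm] with ω h1 h2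
  rw [Measure.real, h1, ENNReal.toReal_ofReal h2]

end L1

/-! ### Setwise limits in probability -/

section Setwise

variable {X Ω : Type*} [MetricSpace X] [MeasurableSpace X] [MeasurableSpace Ω] {P : Measure Ω}
  {𝒬 : ℕ → Set (Set X)} {B : Ω → Set X} {ν τ : Measure X} {μ σ : Ω → Measure X}

/-- The random measure `σ` is the limit of `𝒞ₖ(τ)` in probability on every set of finite
`τ`-measure, and its intensity is at most `τ`. -/
structure IsSetwiseLimit (P : Measure Ω) (𝒬 : ℕ → Set (Set X)) (B : Ω → Set X) (τ : Measure X)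
    (σ : Ω → Measure X) : Prop where
  aemeasurable : AEMeasurable σ P
  bind_le : P.bind σ ≤ τ
  tendsto : ∀ A, MeasurableSet A → τ A < ∞ →
    TendstoInMeasure P (fun k ω => (condApprox P 𝒬 B τ k ω).real A) atTop
      (fun ω => (σ ω).real A)

namespace IsSetwiseLimit

variable [IsFiniteMeasure P]

theorem tendsto_integral (h : IsSetwiseLimit P 𝒬 B τ σ) (h𝒬 : IsNestedSequence 𝒬)
    (hB : IsRandomClosedSet P 𝒬 B) (hτ : τ (coveredSet 𝒬)ᶜ = 0) {f : X → ℝ}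
    (hf : Integrable f τ) :
    TendstoInMeasure P (fun k ω => ∫ x, f x ∂(condApprox P 𝒬 B τ k ω)) atTop
      (fun ω => ∫ x, f x ∂(σ ω)) :=
  tendstoInMeasure_integral (fun k => (measurable_condApprox h𝒬 hB τ k).aemeasurable)
    h.aemeasurable (fun k => (bind_condApprox h𝒬 hB hτ k).le) h.bind_le h.tendsto hf

/-- 𝒞ₖ commutes with densities, so the claim on A is the convergence of the integrals of f χ_A. -/
theorem withDensity (h : IsSetwiseLimit P 𝒬 B τ σ) (h𝒬 : IsNestedSequence 𝒬)
    (hB : IsRandomClosedSet P 𝒬 B) (hτ : τ (coveredSet 𝒬)ᶜ = 0) {f : X → ℝ≥0}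
    (hf : Measurable f) :
    IsSetwiseLimit P 𝒬 B (τ.withDensity fun x => f x)
      (fun ω => (σ ω).withDensity fun x => f x) := by
  have hf' : Measurable fun x => (f x : ℝ≥0∞) := hf.coe_nnreal_ennreal
  have hm : AEMeasurable (fun ω => (σ ω).withDensity fun x => (f x : ℝ≥0∞)) P := by
    refine Measurable.comp_aemeasurable (g := fun m : Measure X => m.withDensity fun x =>
      (f x : ℝ≥0∞)) (Measure.measurable_of_measurable_coe _ fun A hA => ?_) h.aemeasurable
    simp only [withDensity_apply _ hA, ← lintegral_indicator hA]
    exact Measure.measurable_lintegral (hf'.indicator hA)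
  refine ⟨hm, Measure.le_iff.2 fun A hA => ?_, fun A hA hAfin => ?_⟩
  · rw [Measure.bind_apply hA hm]
    simp only [withDensity_apply _ hA, ← lintegral_indicator hA]
    rw [← Measure.lintegral_bind h.aemeasurable (hf'.indicator hA).aemeasurable]
    exact lintegral_mono' h.bind_le le_rfl
  · rw [withDensity_apply _ hA] at hAfin
    have hreal : ∀ m : Measure X, (m.withDensity fun x => (f x : ℝ≥0∞)).real A =
        ∫ x, A.indicator (fun x => (f x : ℝ)) x ∂m := fun m => by
      rw [Measure.real, withDensity_apply _ hA, integral_indicator hA,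
        integral_eq_lintegral_of_nonneg_ae (f := fun x => (f x : ℝ))
          (Eventually.of_forall fun x => (f x).2) hf.coe_nnreal_real.aestronglyMeasurable]
      simp
    have hint : Integrable (A.indicator fun x => (f x : ℝ)) τ := by
      rw [integrable_indicator_iff hA]
      refine ⟨hf.coe_nnreal_real.aestronglyMeasurable, ?_⟩
      simpa [HasFiniteIntegral] using hAfin
    have := h.tendsto_integral h𝒬 hB hτ hint
    simpa only [condApprox_withDensity h𝒬, hreal] using this

theorem isWeakLimit [BorelSpace X] [SecondCountableTopology X] [IsFiniteMeasure τ]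
    (h : IsSetwiseLimit P 𝒬 B τ σ) (h𝒬 : IsNestedSequence 𝒬) (hB : IsRandomClosedSet P 𝒬 B)
    (hτ : τ (coveredSet 𝒬)ᶜ = 0) : IsWeakLimit P 𝒬 B τ σ := by
  have hfin : ∀ {ρ : Ω → Measure X}, AEMeasurable ρ P → P.bind ρ ≤ τ →
      ∀ᵐ ω ∂P, IsFiniteMeasure (ρ ω) := by
    intro ρ hρ hle
    filter_upwards [ae_apply_lt_top hρ MeasurableSet.univ
      (ne_top_of_le_ne_top (measure_ne_top τ univ) (hle univ))] with ω hω
    exact ⟨hω⟩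
  refine ⟨⟨h.aemeasurable, hfin h.aemeasurable h.bind_le⟩, ?_⟩
  exact weaklyConvergesSubseq_of_isOpen
    (fun k => hfin (measurable_condApprox h𝒬 hB τ k).aemeasurable (bind_condApprox h𝒬 hB hτ k).le)
    (hfin h.aemeasurable h.bind_le)
    fun G hG => h.tendsto G hG.measurableSet (measure_lt_top τ G)

end IsSetwiseLimit

/-- Local almost sure statements can be checked on these countably many neighbourhoods outside one
common null set. -/
theorem exists_countable_finite_nhds [SecondCountableTopology X] (τ : Measure X)
    [IsLocallyFiniteMeasure τ] : ∃ b : Set (Set X), b.Countable ∧ (∀ u ∈ b, IsOpen u ∧ τ u < ∞) ∧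
      ∀ x G, IsOpen G → x ∈ G → ∃ u ∈ b, x ∈ u ∧ u ⊆ G := by
  have hb := TopologicalSpace.isBasis_countableBasis X
  refine ⟨{u ∈ TopologicalSpace.countableBasis X | τ u < ∞},
    (TopologicalSpace.countable_countableBasis X).mono fun u hu => hu.1,
    fun u hu => ⟨hb.isOpen hu.1, hu.2⟩, fun x G hG hx => ?_⟩
  obtain ⟨s, hxs, hs, hsfin⟩ := τ.exists_isOpen_measure_lt_top x
  obtain ⟨u, hu, hxu, hus⟩ := hb.exists_subset_of_mem_open (mem_inter hx hxs) (hG.inter hs)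
  exact ⟨u, ⟨hu, (measure_mono (hus.trans inter_subset_right)).trans_lt hsfin⟩, hxu,
    hus.trans inter_subset_left⟩

theorem IsSetwiseLimit.isVagueLimit [IsFiniteMeasure P] [BorelSpace X] [SecondCountableTopology X]
    [IsLocallyFiniteMeasure τ] (h : IsSetwiseLimit P 𝒬 B τ σ) (h𝒬 : IsNestedSequence 𝒬)
    (hB : IsRandomClosedSet P 𝒬 B) (hτ : τ (coveredSet 𝒬)ᶜ = 0) : IsVagueLimit P 𝒬 B τ σ := by
  refine ⟨⟨h.aemeasurable, ?_⟩, fun f hf hfc =>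
    h.tendsto_integral h𝒬 hB hτ (hf.integrable_of_hasCompactSupport hfc)⟩
  obtain ⟨b, hbc, hb, hbx⟩ := exists_countable_finite_nhds τ
  have hfin : ∀ᵐ ω ∂P, ∀ u ∈ b, σ ω u < ∞ := (ae_ball_iff hbc).2 fun u hu =>
    ae_apply_lt_top h.aemeasurable (hb u hu).1.measurableSet
      (ne_top_of_le_ne_top (hb u hu).2.ne (h.bind_le u))
  filter_upwards [hfin] with ω hω
  refine ⟨fun x => ?_⟩
  obtain ⟨u, hu, hxu, -⟩ := hbx x univ isOpen_univ (mem_univ x)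
  exact ⟨u, (hb u hu).1.mem_nhds hxu, hω u hu⟩

/-- The intensity is at most ν, so almost every μ(ω) is carried by the support of ν. A point at
distance d > 0 from B has a basic neighbourhood staying d/2 away from B; its approximating masses
vanish once the cells are smaller, hence so does its limit mass. -/
theorem IsSetwiseLimit.ae_support_subset [IsFiniteMeasure P] [BorelSpace X]
    [SecondCountableTopology X] [IsLocallyFiniteMeasure ν] (h : IsSetwiseLimit P 𝒬 B ν μ)
    (h𝒬 : IsNestedSequence 𝒬) (hB : IsRandomClosedSet P 𝒬 B) :
    ∀ᵐ ω ∂P, (μ ω).support ⊆ ν.support ∩ B ω := by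
  obtain ⟨b, hbc, hb, hbx⟩ := exists_countable_finite_nhds ν
  have hfar : ∀ᵐ ω ∂P, ∀ u ∈ b,
      (∃ r : ℝ≥0∞, 0 < r ∧ ∀ x ∈ u, ∀ y ∈ B ω, r ≤ edist x y) → μ ω u = 0 := by
    refine (ae_ball_iff hbc).2 fun u hu => ?_
    have hum := (hb u hu).1.measurableSet
    obtain ⟨ns, hns, hlim⟩ := (h.tendsto u hum (hb u hu).2).exists_seq_tendsto_ae
    filter_upwards [hlim, ae_apply_lt_top h.aemeasurable hum
      (ne_top_of_le_ne_top (hb u hu).2.ne (h.bind_le u))] with ω hω hfin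
    rintro ⟨r, hr, hru⟩
    have hz : Tendsto (fun i => (condApprox P 𝒬 B ν (ns i) ω).real u) atTop (𝓝 0) := by
      refine tendsto_const_nhds.congr' ?_
      filter_upwards [hns.tendsto_atTop.eventually (eventually_ediam_lt h𝒬 hr)] with i hi
      rw [Measure.real, condApprox_eq_zero_of_far hum hi hru, ENNReal.toReal_zero]
    have := tendsto_nhds_unique hω hz
    exact ((ENNReal.toReal_eq_zero_iff _).1 this).resolve_right hfin.ne
  have hsupp : ∀ᵐ ω ∂P, ∀ᵐ x ∂(μ ω), x ∈ ν.support :=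
    Measure.ae_ae_of_ae_bind h.aemeasurable (ae_mono h.bind_le Measure.support_mem_ae)
  filter_upwards [hfar, hsupp] with ω h1 h2
  refine subset_inter (Measure.support_subset_of_isClosed Measure.isClosed_support h2)
    fun x hx => ?_
  by_contra hxB
  have hd : 0 < Metric.infEDist x (B ω) := by
    refine pos_iff_ne_zero.2 fun h0 => hxB ?_
    rw [← (hB.isClosed ω).closure_eq]
    exact Metric.mem_closure_iff_infEDist_zero.2 h0
  set d := Metric.infEDist x (B ω)
  obtain ⟨u, hu, hxu, hud⟩ := hbx x (Metric.eball x (d / 2)) Metric.isOpen_eball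
    (Metric.mem_eball_self (ENNReal.half_pos hd.ne'))
  have h0 := h1 u hu ⟨d / 2, ENNReal.half_pos hd.ne', fun x' hx' y hy => ?_⟩
  · exact ((Measure.mem_support_iff_forall x).1 hx u ((hb u hu).1.mem_nhds hxu)).ne' h0
  · by_contra hlt
    have h3 : edist x x' < d / 2 := by
      rw [edist_comm]
      exact Metric.mem_eball.1 (hud hx')
    have h4 : d ≤ edist x x' + edist x' y :=
      (Metric.infEDist_le_edist_of_mem hy).trans (edist_triangle _ _ _)
    have h5 := h4.trans_lt (ENNReal.add_lt_add h3 (not_le.1 hlt))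
    rw [ENNReal.add_halves] at h5
    exact absurd h5 (lt_irrefl _)

/-- A countable decomposition of the measure induces one of the limiting random measure. -/
theorem IsSetwiseLimit.exists_sum [IsFiniteMeasure P] [SigmaFinite ν]
    (h : IsSetwiseLimit P 𝒬 B ν μ) (h𝒬 : IsNestedSequence 𝒬) (hB : IsRandomClosedSet P 𝒬 B)
    (hν : ν (coveredSet 𝒬)ᶜ = 0) {νs : ℕ → Measure X} [∀ i, SigmaFinite (νs i)]
    (hsum : ν = Measure.sum νs) :
    ∃ σ : ℕ → Ω → Measure X, (∀ i, IsSetwiseLimit P 𝒬 B (νs i) (σ i)) ∧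
      ∀ᵐ ω ∂P, μ ω = Measure.sum fun i => σ i ω := by
  have hle : ∀ i, νs i ≤ ν := fun i => hsum ▸ Measure.le_sum νs i
  -- The limits for the summands are `g i` times μ. These densities sum to 1 almost everywhere for
  -- ν, hence for almost every μ(ω), whose intensity is at most ν.
  let g : ℕ → X → ℝ≥0 := fun i x => ((νs i).rnDeriv ν x).toNNReal
  have hg : ∀ i, Measurable (g i) := fun i => (Measure.measurable_rnDeriv _ _).ennreal_toNNReal
  have hνs : ∀ i, ν.withDensity (fun x => (g i x : ℝ≥0∞)) = νs i := fun i => by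
    rw [← Measure.withDensity_rnDeriv_eq (νs i) ν (Measure.absolutelyContinuous_of_le (hle i))]
    refine withDensity_congr_ae ?_
    filter_upwards [Measure.rnDeriv_lt_top (νs i) ν] with x hx
    exact ENNReal.coe_toNNReal hx.ne
  have hg1 : (∑' i, fun x => (g i x : ℝ≥0∞)) =ᵐ[ν] 1 := by
    refine (withDensity_eq_iff_of_sigmaFinite ?_ measurable_one.aemeasurable).1 ?_
    · have he : (∑' i, fun x => (g i x : ℝ≥0∞)) = fun x => ∑' i, (g i x : ℝ≥0∞) := by
        ext x
        exact tsum_apply (Pi.summable.2 fun _ => ENNReal.summable)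
      rw [he]
      exact (Measurable.tsum fun i => (hg i).coe_nnreal_ennreal).aemeasurable
    · rw [withDensity_tsum fun i => (hg i).coe_nnreal_ennreal]
      simp only [hνs]
      rw [← hsum, withDensity_one]
  refine ⟨fun i ω => (μ ω).withDensity fun x => (g i x : ℝ≥0∞), fun i => ?_, ?_⟩
  · have := h.withDensity h𝒬 hB hν (hg i)
    rwa [hνs i] at this
  · filter_upwards [Measure.ae_ae_of_ae_bind h.aemeasurable (ae_mono h.bind_le hg1)] with ω hω
    rw [← withDensity_tsum fun i => (hg i).coe_nnreal_ennreal, withDensity_congr_ae hω,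
      withDensity_one]

end Setwise

/-! ### The decomposition of the approximations -/

section Decomposition

variable {X Ω : Type*} [MetricSpace X] [MeasurableSpace X] [MeasurableSpace Ω] {P : Measure Ω}
  {φ : ℝ≥0 → ℝ≥0∞} {𝒬 : ℕ → Set (Set X)} {B : Ω → Set X} {ν νR νS : Measure X}

theorem IsDecomposition.regular_le (hD : IsDecomposition φ ν νR νS) : νR ≤ ν := by
  conv_rhs => rw [hD.eq_add]
  exact Measure.le_add_right le_rfl

theorem IsDecomposition.singular_le (hD : IsDecomposition φ ν νR νS) : νS ≤ ν := by
  conv_rhs => rw [hD.eq_add]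
  exact Measure.le_add_left le_rfl

/-- νS is singular to ν|_D, yet on D it is dominated by it. -/
theorem IsDecomposition.singular_eq_zero [IsLocallyFiniteMeasure ν]
    (hD : IsDecomposition φ ν νR νS) {D : Set X} (hDe : energy φ (ν.restrict D) < ∞) :
    νS D = 0 := by
  obtain ⟨s, hs, hs1, hs2⟩ := hD.singular (ν.restrict D) inferInstance hDe
  rw [Measure.restrict_apply hs.compl] at hs2
  have h3 : νS (sᶜ ∩ D) = 0 := le_antisymm ((hD.singular_le _).trans_eq hs2) zero_le
  refine measure_mono_null (fun x hx => ?_) (measure_union_null hs1 h3)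
  by_cases hxs : x ∈ s
  · exact Or.inl hxs
  · exact Or.inr ⟨hxs, hx⟩

theorem IsDecomposition.condApprox_eq (hD : IsDecomposition φ ν νR νS) (k : ℕ) (ω : Ω) :
    condApprox P 𝒬 B ν k ω = condApprox P 𝒬 B νR k ω + condApprox P 𝒬 B νS k ω :=
  (congrArg (fun m => condApprox P 𝒬 B m k ω) hD.eq_add).trans condApprox_add

theorem IsDecomposition.condApprox_real_eq_of_energy [IsLocallyFiniteMeasure ν]
    (hD : IsDecomposition φ ν νR νS) {D : Set X} (hDe : energy φ (ν.restrict D) < ∞)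
    (k : ℕ) (ω : Ω) : (condApprox P 𝒬 B ν k ω).real D = (condApprox P 𝒬 B νR k ω).real D := by
  rw [Measure.real, hD.condApprox_eq, Measure.add_apply,
    condApprox_absolutelyContinuous (hD.singular_eq_zero hDe), add_zero, Measure.real]

theorem IsDecomposition.condApprox_real_ae_eq [IsFiniteMeasure P]
    (hD : IsDecomposition φ ν νR νS) (h𝒬 : IsNestedSequence 𝒬) (hB : IsRandomClosedSet P 𝒬 B)
    (hν : ν (coveredSet 𝒬)ᶜ = 0) {A : Set X} (hA : MeasurableSet A) (hAfin : ν A < ∞) (k : ℕ) :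
    ∀ᵐ ω ∂P, (condApprox P 𝒬 B ν k ω).real A =
      (condApprox P 𝒬 B νR k ω).real A + (condApprox P 𝒬 B νS k ω).real A := by
  have hm := (measurable_condApprox h𝒬 hB ν k).aemeasurable (μ := P)
  filter_upwards [ae_apply_lt_top hm hA (by rw [bind_condApprox h𝒬 hB hν k]; exact hAfin.ne)]
    with ω hω
  rw [hD.condApprox_eq, Measure.add_apply] at hω
  rw [hD.condApprox_eq]
  exact measureReal_add_apply (ENNReal.add_lt_top.1 hω).1.ne (ENNReal.add_lt_top.1 hω).2.ne

variable [CompleteSpace X] [SecondCountableTopology X] [BorelSpace X] [IsFiniteMeasure P]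

/-- `ℒ¹`-convergence on compact sets of finite energy implies `ℒ¹`-convergence of the
approximations of the regular part on all sets of finite measure. -/
theorem IsDecomposition.exists_convergesInL1To [IsLocallyFiniteMeasure ν]
    (hD : IsDecomposition φ ν νR νS) (h𝒬 : IsNestedSequence 𝒬) (hB : IsRandomClosedSet P 𝒬 B)
    (hν : ν (coveredSet 𝒬)ᶜ = 0)
    (hcrit : ∀ D : Set X, IsCompact D → energy φ (ν.restrict D) < ∞ →
      ∃ Z : Ω → ℝ, ConvergesInL1To P (fun k ω => (condApprox P 𝒬 B ν k ω).real D) Z)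
    {A : Set X} (hA : MeasurableSet A) (hAfin : νR A < ∞) :
    ∃ Z : Ω → ℝ, ConvergesInL1To P (fun k ω => (condApprox P 𝒬 B νR k ω).real A) Z := by
  have hνR : νR (coveredSet 𝒬)ᶜ = 0 := le_antisymm ((hD.regular_le _).trans_eq hν) zero_le
  have hκ : ∀ k, AEMeasurable (condApprox P 𝒬 B νR k) P := fun k =>
    (measurable_condApprox h𝒬 hB νR k).aemeasurable
  have hbind : ∀ k, P.bind (condApprox P 𝒬 B νR k) = νR := bind_condApprox h𝒬 hB hνR
  obtain ⟨E, hE, hEd, hRE, -, hEe⟩ := hD.exists_sets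
  have hfin : ∀ S : Set X, νR (A ∩ S) ≠ ∞ := fun S =>
    measure_ne_top_of_subset inter_subset_left hAfin.ne
  -- Compact subsets of `E n` inherit finite energy, so the hypothesis applies to them, and they
  -- approximate A ∩ `E n` from inside.
  have hpiece : ∀ n, ∃ Z, ConvergesInL1To P
      (fun k ω => (condApprox P 𝒬 B νR k ω).real (A ∩ E n)) Z := by
    intro n
    refine exists_convergesInL1To_of_approx hκ hbind (hA.inter (hE n)) (hfin _) fun ε hε => ?_
    obtain ⟨K, hKsub, hK, hKε⟩ := (hA.inter (hE n)).exists_isCompact_sdiff_lt (hfin _) hε.ne'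
    have hKe : energy φ (ν.restrict K) < ∞ := by
      refine energy_lt_top_of_le_smul (c := 1) ENNReal.one_ne_top ?_ (hEe n)
      rw [one_smul]
      exact Measure.restrict_mono (hKsub.trans inter_subset_right) le_rfl
    obtain ⟨Z, hZ⟩ := hcrit K hK hKe
    refine ⟨K, hKsub, hK.measurableSet, hKε, Z, hZ.congr (fun k => ?_) EventuallyEq.rfl⟩
    exact Eventually.of_forall fun ω => hD.condApprox_real_eq_of_energy hKe k ω
  have hU : ∀ n, MeasurableSet (accumulate E n) := fun n =>
    MeasurableSet.biUnion (to_countable _) fun i _ => hE i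
  have hacc : ∀ n, ∃ Z, ConvergesInL1To P
      (fun k ω => (condApprox P 𝒬 B νR k ω).real (A ∩ accumulate E n)) Z := by
    intro n
    induction n with
    | zero => rw [accumulate_zero_nat]; exact hpiece 0
    | succ n ih =>
      obtain ⟨Z, hZ⟩ := ih
      obtain ⟨Z', hZ'⟩ := hpiece (n + 1)
      rw [accumulate_succ, inter_union_distrib_left]
      exact ⟨_, convergesInL1To_union hκ hbind (hA.inter (hU n)) (hA.inter (hE (n + 1)))
        ((disjoint_accumulate hEd n.lt_succ_self).mono inter_subset_right inter_subset_right)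
        (hfin _) (hfin _) hZ hZ'⟩
  refine exists_convergesInL1To_of_approx hκ hbind hA hAfin.ne fun ε hε => ?_
  -- νR is carried by the union of the `E n`.
  have hlim : Tendsto (fun n => νR (A \ (A ∩ accumulate E n))) atTop (𝓝 0) := by
    have h1 := tendsto_measure_iInter_atTop (μ := νR) (s := fun n => A \ (A ∩ accumulate E n))
      (fun n => (hA.diff (hA.inter (hU n))).nullMeasurableSet)
      (fun i j hij => sdiff_subset_sdiff_right (inter_subset_inter_right _
        (monotone_accumulate hij))) ⟨0, measure_ne_top_of_subset sdiff_subset hAfin.ne⟩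
    have h2 : νR (⋂ n, A \ (A ∩ accumulate E n)) = 0 := by
      rw [← sdiff_iUnion, ← inter_iUnion, iUnion_accumulate, sdiff_self_inter, hRE,
        Measure.restrict_apply (hA.diff (MeasurableSet.iUnion hE)), sdiff_inter_self, measure_empty]
    rwa [h2] at h1
  obtain ⟨n, hn⟩ := (hlim.eventually_lt_const hε).exists
  exact ⟨A ∩ accumulate E n, inter_subset_left, hA.inter (hU n), hn, hacc n⟩

/-- Inner regularity: passing from A to a compact K costs τ(A \ K) in ℒ¹ for every k. -/
theorem tendstoInMeasure_zero_of_isCompact {τ : Measure X} (h𝒬 : IsNestedSequence 𝒬)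
    (hB : IsRandomClosedSet P 𝒬 B) (hτ : τ (coveredSet 𝒬)ᶜ = 0)
    (hcrit : ∀ D : Set X, IsCompact D →
      TendstoInMeasure P (fun k ω => (condApprox P 𝒬 B τ k ω).real D) atTop (fun _ => 0))
    {A : Set X} (hA : MeasurableSet A) (hAfin : τ A < ∞) :
    TendstoInMeasure P (fun k ω => (condApprox P 𝒬 B τ k ω).real A) atTop (fun _ => 0) := by
  have hκ : ∀ k, AEMeasurable (condApprox P 𝒬 B τ k) P := fun k =>
    (measurable_condApprox h𝒬 hB τ k).aemeasurable
  refine tendstoInMeasure_of_approx (fun k => aemeasurable_real (hκ k) hA) aemeasurable_const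
    fun ε hε => ?_
  obtain ⟨K, hKsub, hK, hKε⟩ := hA.exists_isCompact_sdiff_lt hAfin.ne hε.ne'
  refine ⟨_, _, fun k => aemeasurable_real (hκ k) hK.measurableSet, aemeasurable_const,
    hcrit K hK, fun k => ?_, by simp⟩
  rw [lintegral_enorm_real_sub (hκ k) hA hK.measurableSet hKsub
    (by rw [bind_condApprox h𝒬 hB hτ k]; exact hAfin.ne), bind_condApprox h𝒬 hB hτ k]
  exact hKε.le

end Decomposition

/-! ### The existence criterion -/

section Criterion

variable {X Ω : Type*} [MetricSpace X] [SecondCountableTopology X] [MeasurableSpace X]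
  [BorelSpace X] [MeasurableSpace Ω] {P : Measure Ω} {φ : ℝ≥0 → ℝ≥0∞}
  {𝒬 : ℕ → Set (Set X)} {B : Ω → Set X} {ν : Measure X} [IsLocallyFiniteMeasure ν]
  {IsLim : Measure X → (Ω → Measure X) → Prop} {Adm : (X → ℝ≥0) → Prop}

theorem CondMeasureProps.existenceCriterion [IsFiniteMeasure P] (h𝒬 : IsNestedSequence 𝒬)
    (hB : IsRandomClosedSet P 𝒬 B) (hν : ν (coveredSet 𝒬)ᶜ = 0) {μ : Ω → Measure X}
    {S : (X → ℝ) → Ω → ℝ} (h : CondMeasureProps P 𝒬 B φ ν IsLim Adm μ S) :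
    ExistenceCriterion P 𝒬 B φ ν := by
  have hD := isDecomposition_parts φ ν
  refine ⟨fun D hDc hDe => ?_, fun D hDc => ?_⟩
  · refine ⟨_, (h.tendsto_L1 D hDc.measurableSet hDc.measure_lt_top).congr (fun k => ?_)
      EventuallyEq.rfl⟩
    exact Eventually.of_forall fun ω => (hD.condApprox_real_eq_of_energy hDe k ω).symm
  · have hDm := hDc.measurableSet
    have hDfin : ν D < ∞ := hDc.measure_lt_top
    have h1 := (h.integral_tendsto (D.indicator 1) (measurable_one.indicator hDm)
      ((integrable_indicator_iff hDm).2 (integrableOn_const hDfin.ne))).1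
    simp only [integral_indicator_one hDm] at h1
    have h2 : S (D.indicator 1) =ᵐ[P] fun ω => (μ ω).real D := by
      filter_upwards [h.measure_eq (fun _ => D) (fun _ => hDm) (fun _ => hDfin)] with ω hω
      exact (hω 0).2
    have hm : ∀ τ : Measure X, ∀ k, AEMeasurable (fun ω => (condApprox P 𝒬 B τ k ω).real D) P :=
      fun τ k => aemeasurable_real (measurable_condApprox h𝒬 hB τ k).aemeasurable hDm
    -- 𝒞ₖ(ν)(D) - 𝒞ₖ(ν_R)(D): both terms tend to μ(D) in probability, and almost surely the
    -- difference is 𝒞ₖ(ν_⊥)(D).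
    have h3 := tendstoInMeasure_add (h1.congr_right h2) (tendstoInMeasure_const_mul
      (h.tendsto_L1 D hDm hDfin).tendstoInMeasure (hm _) (-1)) (hm ν)
      (fun k => (hm _ k).const_mul (-1))
    refine h3.congr (fun k => ?_) (Eventually.of_forall fun ω => by ring)
    filter_upwards [hD.condApprox_real_ae_eq h𝒬 hB hν hDm hDfin k] with ω hω
    rw [hω]
    ring

/-- Under the existence criterion there is a random measure whose intensity is the regular part
and which is the setwise limit of the approximations of `ν` and of its regular part. -/
theorem ExistenceCriterion.exists_randomMeasure [CompleteSpace X] [IsFiniteMeasure P]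
    (h : ExistenceCriterion P 𝒬 B φ ν) (h𝒬 : IsNestedSequence 𝒬)
    (hB : IsRandomClosedSet P 𝒬 B) (hν : ν (coveredSet 𝒬)ᶜ = 0) :
    ∃ μ : Ω → Measure X, AEMeasurable μ P ∧ P.bind μ = regularPart φ ν ∧
      (∀ A, MeasurableSet A → regularPart φ ν A < ∞ →
        ConvergesInL1To P (fun k ω => (condApprox P 𝒬 B (regularPart φ ν) k ω).real A)
          (fun ω => (μ ω).real A)) ∧
      IsSetwiseLimit P 𝒬 B ν μ ∧ IsSetwiseLimit P 𝒬 B (regularPart φ ν) μ ∧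
      IsSetwiseLimit P 𝒬 B (singularPart φ ν) (fun _ => 0) := by
  have hD := isDecomposition_parts φ ν
  have hνR : regularPart φ ν (coveredSet 𝒬)ᶜ = 0 :=
    le_antisymm ((hD.regular_le _).trans_eq hν) zero_le
  have hνS : singularPart φ ν (coveredSet 𝒬)ᶜ = 0 :=
    le_antisymm ((hD.singular_le _).trans_eq hν) zero_le
  have := hD.locallyFinite_regular
  obtain ⟨μ, hμ, hμb, hμL⟩ := exists_randomMeasure_convergesInL1To (m := regularPart φ ν)
    (fun k => (measurable_condApprox h𝒬 hB (regularPart φ ν) k).aemeasurable)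
    (bind_condApprox h𝒬 hB hνR)
    (fun A hA hAfin => hD.exists_convergesInL1To h𝒬 hB hν h.1 hA hAfin)
  have hS : ∀ A, MeasurableSet A → singularPart φ ν A < ∞ → TendstoInMeasure P
      (fun k ω => (condApprox P 𝒬 B (singularPart φ ν) k ω).real A) atTop (fun _ => 0) :=
    fun A hA hAfin => tendstoInMeasure_zero_of_isCompact h𝒬 hB hνS h.2 hA hAfin
  refine ⟨μ, hμ.aemeasurable, hμb, hμL, ⟨hμ.aemeasurable, hμb.trans_le hD.regular_le,
    fun A hA hAfin => ?_⟩, ⟨hμ.aemeasurable, hμb.le,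
    fun A hA hAfin => (hμL A hA hAfin).tendstoInMeasure⟩, ⟨aemeasurable_const, ?_, ?_⟩⟩
  · have hm : ∀ τ : Measure X, ∀ k, AEMeasurable (fun ω => (condApprox P 𝒬 B τ k ω).real A) P :=
      fun τ k => aemeasurable_real (measurable_condApprox h𝒬 hB τ k).aemeasurable hA
    refine (tendstoInMeasure_add
      (hμL A hA ((hD.regular_le A).trans_lt hAfin)).tendstoInMeasure
      (hS A hA ((hD.singular_le A).trans_lt hAfin)) (hm _) (hm _)).congr (fun k => ?_)
      (Eventually.of_forall fun ω => add_zero _)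
    filter_upwards [hD.condApprox_real_ae_eq h𝒬 hB hν hA hAfin k] with ω hω
    exact hω.symm
  · rw [Measure.bind_zero_right']
    exact Measure.zero_le _
  · simpa using hS

/-- Both settings at once: `Good` stands for finite or locally finite, and `hLim` turns setwise
limits into the mode of convergence of the setting. The constant c in `hGood` accommodates multiples
γν. -/
theorem ExistenceCriterion.exists_condMeasureProps [CompleteSpace X] [IsFiniteMeasure P]
    (h : ExistenceCriterion P 𝒬 B φ ν) (h𝒬 : IsNestedSequence 𝒬)
    (hB : IsRandomClosedSet P 𝒬 B) (hν : ν (coveredSet 𝒬)ᶜ = 0) (Good : Measure X → Prop)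
    (hGood : ∀ (c : ℝ≥0) (τ : Measure X), τ ≤ c • ν → Good τ)
    (hAdm : ∀ f : X → ℝ≥0, Measurable f → Adm f → Good (ν.withDensity fun x => f x))
    (hLim : ∀ τ σ, Good τ → τ (coveredSet 𝒬)ᶜ = 0 → IsSetwiseLimit P 𝒬 B τ σ → IsLim τ σ) :
    ∃ μ S, CondMeasureProps P 𝒬 B φ ν IsLim Adm μ S := by
  have hD := isDecomposition_parts φ ν
  have hRle := hD.regular_le
  obtain ⟨μ, hμ, hμb, hμL, hlim, hlimR, hlimS⟩ := h.exists_randomMeasure h𝒬 hB hν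
  have hle : ∀ τ, τ ≤ ν → Good τ := fun τ hτ => hGood 1 τ (by rwa [one_smul])
  have hcov : ∀ τ : Measure X, τ ≪ ν → τ (coveredSet 𝒬)ᶜ = 0 := fun τ hτ => hτ hν
  have hint : ∀ f : X → ℝ, Integrable f ν → Integrable f (P.bind μ) := fun f hf =>
    hf.mono_measure hlim.bind_le
  have hE : ∀ f : X → ℝ, Integrable f ν →
      ∫ ω, ∫ x, f x ∂(μ ω) ∂P = ∫ x, f x ∂(regularPart φ ν) := fun f hf => by
    rw [integral_integral_eq hμ (hint f hf), hμb]
  have hdens : ∀ f : X → ℝ≥0, Measurable f → Good (ν.withDensity fun x => f x) →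
      IsLim (ν.withDensity fun x => f x) (fun ω => (μ ω).withDensity fun x => f x) :=
    fun f hf hg => hLim _ _ hg (hcov _ (withDensity_absolutelyContinuous _ _))
      (hlim.withDensity h𝒬 hB hν hf)
  -- S(f) is taken to be ∫ f dμ itself, so its identities with μ need only integrability.
  refine ⟨μ, fun f ω => ∫ x, f x ∂(μ ω), ?_⟩
  constructor
  · exact hLim ν μ (hle ν le_rfl) hν hlim
  · exact fun f _ hf => ⟨hlim.tendsto_integral h𝒬 hB hν hf, integrable_integral hμ (hint f hf),
      integrable_integral hμ (hint f hf), rfl, hE f hf⟩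
  · intro f _ hf
    filter_upwards [ae_all_iff.2 fun n => ae_integrable hμ (hint _ (hf n))] with ω hω n
    exact ⟨hω n, rfl⟩
  · intro A hA hAfin
    filter_upwards [ae_all_iff.2 fun n => ae_apply_lt_top hμ (hA n)
      (ne_top_of_le_ne_top (hAfin n).ne (hlim.bind_le _))] with ω hω n
    exact ⟨hω n, integral_indicator_one (hA n)⟩
  · intro A hA hAfin
    refine ⟨by rw [← hμb, Measure.bind_apply hA hμ], ?_, hRle A⟩
    have hi : Integrable (A.indicator (1 : X → ℝ)) ν :=
      (integrable_indicator_iff hA).2 (integrableOn_const hAfin.ne)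
    rw [hE _ hi, integral_indicator_one hA]
  · exact fun A hA hAfin => hμL A hA ((hRle A).trans_lt hAfin)
  · exact hLim _ _ (hle _ hD.singular_le)
      (hcov _ (Measure.absolutelyContinuous_of_le hD.singular_le)) hlimS
  · exact hLim _ _ (hle _ hRle) (hcov _ (Measure.absolutelyContinuous_of_le hRle)) hlimR
  · intro νs hνs hsum
    have hνsle : ∀ i, νs i ≤ ν := fun i => hsum ▸ Measure.le_sum νs i
    obtain ⟨σ, hσ, hμσ⟩ := hlim.exists_sum h𝒬 hB hν hsum
    exact ⟨σ, fun i => hLim _ _ (hle _ (hνsle i))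
      (hcov _ (Measure.absolutelyContinuous_of_le (hνsle i))) (hσ i), hμσ⟩
  · exact fun f hf hfA => hdens f hf (hAdm f hf hfA)
  · intro γ
    have hγ : ∀ m : Measure X, m.withDensity (fun _ => (γ : ℝ≥0∞)) = γ • m := fun m =>
      withDensity_const _
    have := hdens (fun _ => γ) measurable_const (hGood γ _ (hγ ν).le)
    simpa only [hγ] using this
  · exact hlim.ae_support_subset h𝒬 hB

end Criterion

end RandomRestriction

/-! ### The finite and the locally finite setting -/

open RandomRestriction
theorem mainTheorem3
    {X : Type*} [MetricSpace X] [CompleteSpace X] [SecondCountableTopology X]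
    [MeasurableSpace X] [BorelSpace X]
    {Ω : Type*} [MeasurableSpace Ω] (P : Measure Ω) [IsProbabilityMeasure P]
    (φ : ℝ≥0 → ℝ≥0∞) (hφ : IsKernel φ)
    (𝒬 : ℕ → Set (Set X)) (h𝒬 : IsNestedSequence 𝒬)
    (B : Ω → Set X) (hB : IsRandomClosedSet P 𝒬 B)
    (ν : Measure X) [IsLocallyFiniteMeasure ν] (hν : ν (coveredSet 𝒬)ᶜ = 0) :
    (IsFiniteMeasure ν →
      ((∃ μ : Ω → Measure X, IsCondMeasureFinite P 𝒬 B φ ν μ) ↔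
        ExistenceCriterion P 𝒬 B φ ν)) ∧
    (LocallyCompactSpace X →
      ((∃ μ : Ω → Measure X, IsCondMeasureLocallyFinite P 𝒬 B φ ν μ) ↔
        ExistenceCriterion P 𝒬 B φ ν)) := by
  refine ⟨fun hfin => ⟨?_, fun h => ?_⟩, fun _ => ⟨?_, fun h => ?_⟩⟩
  · rintro ⟨μ, S, h⟩
    exact h.existenceCriterion h𝒬 hB hν
  · refine h.exists_condMeasureProps h𝒬 hB hν IsFiniteMeasure (fun c τ hτ => ?_)
      (fun f _ hf => ?_) (fun τ σ _ hτ hσ => hσ.isWeakLimit h𝒬 hB hτ)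
    · exact isFiniteMeasure_of_le _ hτ
    · exact ⟨by rwa [withDensity_apply _ MeasurableSet.univ, Measure.restrict_univ]⟩
  · rintro ⟨μ, S, h⟩
    exact h.existenceCriterion h𝒬 hB hν
  · refine h.exists_condMeasureProps h𝒬 hB hν IsLocallyFiniteMeasure (fun c τ hτ => ?_)
      (fun f _ hf => ⟨fun y => ?_⟩) (fun τ σ _ hτ hσ => hσ.isVagueLimit h𝒬 hB hτ)
    · refine ⟨fun y => ?_⟩
      obtain ⟨U, hyU, hU, hUfin⟩ := ν.exists_isOpen_measure_lt_top y
      exact ⟨U, hU.mem_nhds hyU, (hτ U).trans_lt (ENNReal.mul_lt_top ENNReal.coe_lt_top hUfin)⟩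
    · obtain ⟨U, hU, hUfin⟩ := hf y
      exact ⟨U, hU, by rwa [withDensity_apply']⟩
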